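/- Let $X=(X_1,\dots,X_d)$ be a random vector with continuous marginal distribution functions $F_1,\dots,F_d$, let $U_j=F_j(X_j)$, and let $C$ be the copula of $X$, i.e. the joint distribution function of $U=(U_1,\dots,U_d)$. Let $\mathcal G=\{\mathcal G_1,\dots,\mathcal G_K\}$ be a partition of $\{1,\dots,d\}$ satisfying the partial exchangeability assumption (PEA): $C(u_1,\dots,u_d)=C(u_{\pi(1)},\dots,u_{\pi(d)})$ for all $u\in[0,1]^d$ and every permutation $\pi$ of $\{1,\dots,d\}$ that maps each $\mathcal G_k$ to itself. Let $p=d(d-1)/2$ and index the pairs $i<j$ by $r=1,\dots,p$, writing $r\leftrightarrow(i_r,j_r)$. For $k_1\le k_2$ let $\mathcal B_{k_1k_2}$ be the set of $r$ with $(i_r,j_r)\in(\mathcal G_{k_1}\times\mathcal G_{k_2})\cup(\mathcal G_{k_2}\times\mathcal G_{k_1})$; let $\mathcal B_1,\dots,\mathcal B_L$ be the nonempty ones among these sets, let $B\in\mathbb R^{p\times L}$ have entries $B_{r\ell}=\mathbf 1(r\in\mathcal B_\ell)$, and let $\Gamma=BB^+$, where $B^+$ is the Moore–Penrose inverse of $B$.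 Let $\tau\in\mathbb R^p$ have entries $\tau_r=T_{i_rj_r}$, where $T_{ij}=\Pr\{(X_i-X_i^*)(X_j-X_j^*)>0\}-\Pr\{(X_i-X_i^*)(X_j-X_j^*)<0\}$ is Kendall's tau and $X^*$ is an independent copy of $X$. Given a random sample $X^{(1)},\dots,X^{(n)}$ from $X$ (i.i.d. copies of $X$), with $X^{(m)}=(X_{m1},\dots,X_{md})$, let $\hat\tau\in\mathbb R^p$ have entries $\hat\tau_r=\hat T_{i_rj_r}$, where $\hat T_{ij}=-1+\frac{4}{n(n-1)}\sum_{a\ne b}\mathbf 1(X_{ai}\le X_{bi})\mathbf 1(X_{aj}\le X_{bj})$, and let $\tilde\tau=\Gamma\hat\tau$ be the block-averaged estimator. Let $\Sigma_\infty$ be the $p\times p$ matrix with entries $$(\Sigma_\infty)_{rs}=16\,\mathrm{cov}\{C_{i_rj_r}(U_{i_r},U_{j_r})+\bar C_{i_rj_r}(U_{i_r},U_{j_r}),\;C_{i_sj_s}(U_{i_s},U_{j_s})+\bar C_{i_sj_s}(U_{i_s},U_{j_s})\},$$ where $C_{ij}(a,b)=\Pr(U_i\le a,U_j\le b)$ and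 $\bar C_{ij}(a,b)=\Pr(U_i>a,U_j>b)$; it is the asymptotic covariance matrix of $\hat\tau$, that is, $\sqrt n(\hat\tau-\tau)$ converges in distribution to $\mathcal N(0,\Sigma_\infty)$ as $n\to\infty$. Then: (i) $\Gamma\Sigma_\infty$ is symmetric nonnegative definite and, as $n\to\infty$, $\sqrt n(\tilde\tau-\tau)$ converges in distribution to $\mathcal N(0,\Gamma\Sigma_\infty)$; (ii) the matrix $\Sigma_\infty-\Gamma\Sigma_\infty$ is nonnegative definite, so that $\tilde\tau$ is asymptotically at least as efficient as $\hat\tau$. -/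

import Mathlib

open MeasureTheory ProbabilityTheory Filter Topology
open scoped Matrix

/-! ### The Moore–Penrose generalized inverse of a real matrix -/

/-- `X` satisfies the four Penrose equations for the real matrix `A`. -/
structure IsMoorePenroseInverse {m n : Type*} [Fintype m] [Fintype n]
    (A : Matrix m n ℝ) (X : Matrix n m ℝ) : Prop where
  mul_mul_self : A * X * A = A
  mul_mul_inv : X * A * X = X
  symm_left : (A * X)ᵀ = A * X
  symm_right : (X * A)ᵀ = X * A

theorem IsMoorePenroseInverse.unique {m n : Type*} [Fintype m] [Fintype n]
    {A : Matrix m n ℝ} {X Y : Matrix n m ℝ}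
    (hX : IsMoorePenroseInverse A X) (hY : IsMoorePenroseInverse A Y) : X = Y := by
  have h1 : A * X = A * Y := by
    calc A * X = (A * X)ᵀ := hX.symm_left.symm
      _ = ((A * Y) * (A * X))ᵀ := by rw [← Matrix.mul_assoc, hY.mul_mul_self]
      _ = (A * X) * (A * Y) := by rw [Matrix.transpose_mul, hX.symm_left, hY.symm_left]
      _ = A * Y := by rw [← Matrix.mul_assoc, hX.mul_mul_self]
  have h2 : X * A = Y * A := by
    calc X * A = (X * A)ᵀ := hX.symm_right.symm
      _ = ((X * A) * (Y * A))ᵀ := by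
          rw [Matrix.mul_assoc, ← Matrix.mul_assoc A, hY.mul_mul_self]
      _ = (Y * A) * (X * A) := by rw [Matrix.transpose_mul, hX.symm_right, hY.symm_right]
      _ = Y * A := by rw [Matrix.mul_assoc, ← Matrix.mul_assoc A, hX.mul_mul_self]
  calc X = X * A * X := hX.mul_mul_inv.symm
    _ = Y * A * Y := by rw [h2, Matrix.mul_assoc, h1, ← Matrix.mul_assoc]
    _ = Y := hY.mul_mul_inv

theorem exists_isMoorePenroseInverse {m n : Type*} [Fintype m] [Fintype n]
    (A : Matrix m n ℝ) : ∃ X : Matrix n m ℝ, IsMoorePenroseInverse A X := by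
  classical
  set S : Matrix n n ℝ := Aᵀ * A with hSdef
  have hS : S.IsHermitian := by
    have := Matrix.isHermitian_conjTranspose_mul_self A
    simpa [Matrix.conjTranspose_eq_transpose_of_trivial] using this
  set U : Matrix n n ℝ := (hS.eigenvectorUnitary : Matrix n n ℝ) with hU
  set D : Matrix n n ℝ := Matrix.diagonal hS.eigenvalues with hD
  set E : Matrix n n ℝ := Matrix.diagonal (fun i => (hS.eigenvalues i)⁻¹) with hE
  have hUU : Uᵀ * U = 1 := by
    have := Unitary.coe_star_mul_self hS.eigenvectorUnitary
    simpa [Matrix.star_eq_conjTranspose, Matrix.conjTranspose_eq_transpose_of_trivial] using this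
  have hUU' : ∀ M : Matrix n n ℝ, Uᵀ * (U * M) = M := fun M => by
    rw [← Matrix.mul_assoc, hUU, Matrix.one_mul]
  have hspec : S = U * (D * Uᵀ) := by
    have h := hS.spectral_theorem
    rw [Unitary.conjStarAlgAut_apply] at h
    rw [← Matrix.mul_assoc]
    simpa [Matrix.star_eq_conjTranspose, Matrix.conjTranspose_eq_transpose_of_trivial,
      Function.comp_def] using h
  have hDt : Dᵀ = D := Matrix.diagonal_transpose _
  have hEt : Eᵀ = E := Matrix.diagonal_transpose _
  have hDED : ∀ M : Matrix n n ℝ, D * (E * (D * M)) = D * M := fun M => by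
    rw [← Matrix.mul_assoc, ← Matrix.mul_assoc, hD, hE, Matrix.diagonal_mul_diagonal,
      Matrix.diagonal_mul_diagonal]
    simp [mul_inv_mul_cancel]
  have hEDE : ∀ M : Matrix n n ℝ, E * (D * (E * M)) = E * M := fun M => by
    rw [← Matrix.mul_assoc, ← Matrix.mul_assoc, hD, hE, Matrix.diagonal_mul_diagonal,
      Matrix.diagonal_mul_diagonal]
    congr 2
    funext i
    by_cases h : hS.eigenvalues i = 0
    · simp [h]
    · field_simp
  set Q : Matrix n n ℝ := U * (E * Uᵀ) with hQ
  have hQt : Qᵀ = Q := by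
    rw [hQ, Matrix.transpose_mul, Matrix.transpose_mul, hEt, Matrix.transpose_transpose,
      Matrix.mul_assoc]
  have hSt : Sᵀ = S := by
    rw [hSdef, Matrix.transpose_mul, Matrix.transpose_transpose]
  have hDE : D * E = E * D := by
    rw [hD, hE, Matrix.diagonal_mul_diagonal, Matrix.diagonal_mul_diagonal]
    simp [mul_comm]
  have hSQ : S * Q = Q * S := by
    rw [hspec, hQ]
    simp only [Matrix.mul_assoc, hUU']
    rw [← Matrix.mul_assoc D, hDE, Matrix.mul_assoc]
  have hSQS : S * (Q * S) = S := by
    rw [hspec, hQ]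
    simp only [Matrix.mul_assoc, hUU', hDED]
  have hQSQ : Q * (S * Q) = Q := by
    rw [hspec, hQ]
    simp only [Matrix.mul_assoc, hUU', hEDE]
  have hkey : A * (Q * S) = A := by
    have h0 : (A * (Q * S) - A)ᴴ * (A * (Q * S) - A) = 0 := by
      rw [Matrix.conjTranspose_eq_transpose_of_trivial, Matrix.transpose_sub,
        Matrix.transpose_mul, Matrix.transpose_mul, hQt, hSt]
      have e : (S * Q * Aᵀ - Aᵀ) * (A * (Q * S) - A)
          = S * Q * (S * (Q * S)) - S * Q * S - S * (Q * S) + S := by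
        rw [hSdef]
        simp only [Matrix.sub_mul, Matrix.mul_sub, Matrix.mul_assoc]
        abel
      rw [e, hSQS, Matrix.mul_assoc, hSQS]
      abel
    exact sub_eq_zero.1 (Matrix.conjTranspose_mul_self_eq_zero.1 h0)
  refine ⟨Q * Aᵀ, ?_, ?_, ?_, ?_⟩
  · rw [Matrix.mul_assoc, Matrix.mul_assoc, ← hSdef, hkey]
  · calc Q * Aᵀ * A * (Q * Aᵀ) = Q * (S * Q) * Aᵀ := by
          rw [hSdef]; simp only [Matrix.mul_assoc]
      _ = Q * Aᵀ := by rw [hQSQ]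
  · rw [Matrix.transpose_mul, Matrix.transpose_mul, Matrix.transpose_transpose, hQt,
      Matrix.mul_assoc]
  · rw [Matrix.mul_assoc, ← hSdef, Matrix.transpose_mul, hQt, hSt, hSQ]

/-- The Moore–Penrose generalized inverse `A⁺`. -/
noncomputable def moorePenroseInverse {m n : Type*} [Fintype m] [Fintype n]
    (A : Matrix m n ℝ) : Matrix n m ℝ :=
  Classical.choose (exists_isMoorePenroseInverse A)

theorem moorePenroseInverse_spec {m n : Type*} [Fintype m] [Fintype n]
    (A : Matrix m n ℝ) : IsMoorePenroseInverse A (moorePenroseInverse A) :=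
  Classical.choose_spec (exists_isMoorePenroseInverse A)

/-! ### Copula and partial exchangeability

Throughout, `μ` is the law of the random vector `X = (X_1, …, X_d)`. -/

/-- The `j`-th univariate marginal distribution function `F_j`. -/
noncomputable def marginalCDF {d : ℕ} (μ : Measure (Fin d → ℝ)) (j : Fin d) (t : ℝ) : ℝ :=
  cdf (μ.map (fun x => x j)) t

/-- The map `x ↦ (F_1(x_1), …, F_d(x_d))`. -/
noncomputable def probTransform {d : ℕ} (μ : Measure (Fin d → ℝ)) (x : Fin d → ℝ) :
    Fin d → ℝ :=
  fun j => marginalCDF μ j (x j)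

theorem measurable_probTransform {d : ℕ} (μ : Measure (Fin d → ℝ)) :
    Measurable (probTransform μ) :=
  measurable_pi_lambda _ fun j =>
    (monotone_cdf (μ.map (fun x => x j))).measurable.comp (measurable_pi_apply j)

/-- The law of `U = (F_1(X_1), …, F_d(X_d))`. -/
noncomputable def copulaLaw {d : ℕ} (μ : Measure (Fin d → ℝ)) : Measure (Fin d → ℝ) :=
  μ.map (probTransform μ)

/-- The copula `C`: the joint distribution function of `U`. -/
noncomputable def copula {d : ℕ} (μ : Measure (Fin d → ℝ)) (u : Fin d → ℝ) : ℝ :=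
  (copulaLaw μ).real {v | ∀ j, v j ≤ u j}

/-- The copula `C_{ij}` of `(X_i, X_j)`. -/
noncomputable def pairCopula {d : ℕ} (μ : Measure (Fin d → ℝ)) (i j : Fin d) (a b : ℝ) : ℝ :=
  (copulaLaw μ).real {v | v i ≤ a ∧ v j ≤ b}

/-- The survival function of `C_{ij}`. -/
noncomputable def pairSurvival {d : ℕ} (μ : Measure (Fin d → ℝ)) (i j : Fin d) (a b : ℝ) : ℝ :=
  (copulaLaw μ).real {v | a < v i ∧ b < v j}

/-- The partial exchangeability assumption: the copula is invariant under every permutation of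
the coordinates that maps each cluster of `G` to itself. -/
def PartiallyExchangeable {d : ℕ} (μ : Measure (Fin d → ℝ))
    (G : Finpartition (Finset.univ : Finset (Fin d))) : Prop :=
  ∀ u : Fin d → ℝ, (∀ j, u j ∈ Set.Icc (0 : ℝ) 1) →
    ∀ π : Equiv.Perm (Fin d), (∀ j, ∀ A ∈ G.parts, j ∈ A ↔ π j ∈ A) →
      copula μ u = copula μ (fun j => u (π j))

/-! ### Vectorization, blocks and the projection `Γ` -/

/-- The `p = d (d - 1) / 2` positions `(i, j)`, `i < j`, above the main diagonal. -/
abbrev UpperPair (d : ℕ) : Type := {q : Fin d × Fin d // q.1 < q.2}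

/-- The vector of entries of a `d × d` matrix above its main diagonal. -/
def upperVec {d : ℕ} (R : Matrix (Fin d) (Fin d) ℝ) : UpperPair d → ℝ :=
  fun r => R r.1.1 r.1.2

/-- The block of positions `r` with `(i_r, j_r) ∈ (A × A') ∪ (A' × A)`. -/
def pairBlock {d : ℕ} (A A' : Finset (Fin d)) : Finset (UpperPair d) :=
  Finset.univ.filter fun r =>
    (r.1.1 ∈ A ∧ r.1.2 ∈ A') ∨ (r.1.1 ∈ A' ∧ r.1.2 ∈ A)

/-- The partition of the positions into the nonempty blocks induced by `G`. -/
def blockPartition {d : ℕ} (G : Finpartition (Finset.univ : Finset (Fin d))) :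
    Finset (Finset (UpperPair d)) :=
  ((G.parts ×ˢ G.parts).image fun a => pairBlock a.1 a.2).filter fun b => b.Nonempty

/-- The `p × L` block membership matrix `B`. -/
def blockMembership {d : ℕ} (G : Finpartition (Finset.univ : Finset (Fin d))) :
    Matrix (UpperPair d) {b // b ∈ blockPartition G} ℝ :=
  Matrix.of fun r b => if r ∈ b.1 then 1 else 0

/-- `Γ = B B⁺`. -/
noncomputable def blockProjection {d : ℕ} (G : Finpartition (Finset.univ : Finset (Fin d))) :
    Matrix (UpperPair d) (UpperPair d) ℝ :=
  blockMembership G * moorePenroseInverse (blockMembership G)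

/-! ### Kendall's tau: population and sample versions -/

/-- The matrix `T` of pairwise Kendall correlations: probability of concordance minus probability
of discordance of `X` and an independent copy. -/
noncomputable def kendallMatrix {d : ℕ} (μ : Measure (Fin d → ℝ)) :
    Matrix (Fin d) (Fin d) ℝ :=
  Matrix.of fun i j =>
    (μ.prod μ).real {z | 0 < (z.1 i - z.2 i) * (z.1 j - z.2 j)}
      - (μ.prod μ).real {z | (z.1 i - z.2 i) * (z.1 j - z.2 j) < 0}

/-- The empirical Kendall matrix of the observations `x 0, …, x (n - 1)`. -/
noncomputable def empiricalKendallMatrix {d : ℕ} (n : ℕ) (x : ℕ → Fin d → ℝ) :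
    Matrix (Fin d) (Fin d) ℝ :=
  Matrix.of fun i j =>
    -1 + 4 / ((n : ℝ) * ((n : ℝ) - 1)) *
      ∑ q ∈ (Finset.range n).offDiag,
        (if x q.1 i ≤ x q.2 i then (1 : ℝ) else 0) * (if x q.1 j ≤ x q.2 j then (1 : ℝ) else 0)

/-- `τ`. -/
noncomputable def kendallVec {d : ℕ} (μ : Measure (Fin d → ℝ)) :
    EuclideanSpace ℝ (UpperPair d) :=
  WithLp.toLp 2 (upperVec (kendallMatrix μ))

/-- `τ̂`. -/
noncomputable def empiricalKendallVec {d : ℕ} (n : ℕ) (x : ℕ → Fin d → ℝ) :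
    EuclideanSpace ℝ (UpperPair d) :=
  WithLp.toLp 2 (upperVec (empiricalKendallMatrix n x))

/-- `τ̃ = Γ τ̂`. -/
noncomputable def blockAveragedKendallVec {d : ℕ}
    (G : Finpartition (Finset.univ : Finset (Fin d))) (n : ℕ) (x : ℕ → Fin d → ℝ) :
    EuclideanSpace ℝ (UpperPair d) :=
  WithLp.toLp 2 (blockProjection G *ᵥ upperVec (empiricalKendallMatrix n x))

/-- The asymptotic covariance matrix `Σ_∞`, with entries
`16 cov{C_r(U) + C̄_r(U), C_s(U) + C̄_s(U)}`, where `C_r` is the copula of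
`(X_{i_r}, X_{j_r})`. -/
noncomputable def asymptoticCov {d : ℕ} (μ : Measure (Fin d → ℝ)) :
    Matrix (UpperPair d) (UpperPair d) ℝ :=
  Matrix.of fun r s =>
    16 * cov[fun v => pairCopula μ r.1.1 r.1.2 (v r.1.1) (v r.1.2)
                + pairSurvival μ r.1.1 r.1.2 (v r.1.1) (v r.1.2),
             fun v => pairCopula μ s.1.1 s.1.2 (v s.1.1) (v s.1.2)
                + pairSurvival μ s.1.1 s.1.2 (v s.1.1) (v s.1.2); copulaLaw μ]

/-!
Up to the constant `-1`, the entries of `τ̂` are U-statistics of order two with the bounded kernels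
`4 · 1(x_i ≤ y_i) 1(x_j ≤ y_j)`. In the Hoeffding decomposition the linear part is a normalized sum
of independent vectors, to which the multivariate central limit theorem applies, and the completely
degenerate remainder has second moment of order `1 / n` after scaling by `√n`, because its summands
are uncorrelated unless they involve the same two observations (`tendstoInDistribution_uStatistic`).
Since a continuous distribution function preserves order up to null sets (`ae_cdf_le_cdf_iff`), the
projection of the kernel at `X` is `4 (C_{ij} + C̄_{ij})(U_i, U_j)`, so the limit covariance is
`Σ_∞`; as ties are null, the mean of the kernel is `1 + T_{ij}`.

Partial exchangeability says that the law of `U` is invariant under the cluster-preserving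
permutations of the coordinates (`PartiallyExchangeable.copulaLaw_map`). These permutations act on
the unordered pairs of coordinates, and their orbits are the blocks (`exists_permUpperPair_eq`).
Both `τ` and `Σ_∞` are invariant. Hence `τ` is constant on the blocks, which gives `Γ τ = τ`, and
`Σ_∞` preserves the space of vectors constant on the blocks. As `Γ` is the orthogonal projection
onto that space, it commutes with `Σ_∞` (`blockProjection_mul_comm`). Consequently
`√n (τ̃ - τ) = Γ √n (τ̂ - τ)` has limit covariance `Γ Σ_∞ Γᵀ = Γ Σ_∞`, and
`Σ_∞ - Γ Σ_∞ = (1 - Γ) Σ_∞ (1 - Γ)ᵀ` is nonnegative definite.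
-/

/-! ### Covariance matrices -/

section CovMatrix

variable {ι α : Type*} [MeasurableSpace α]

/-- The covariance matrix of a finite family of real random variables `g r`, `r : ι`. -/
noncomputable def covMatrix (g : ι → α → ℝ) (μ : Measure α) : Matrix ι ι ℝ :=
  Matrix.of fun r s => cov[g r, g s; μ]

theorem dotProduct_covMatrix_mulVec [Fintype ι] {g : ι → α → ℝ} {μ : Measure α}
    [IsProbabilityMeasure μ] (hg : ∀ r, MemLp (g r) 2 μ) (t : ι → ℝ) :
    t ⬝ᵥ covMatrix g μ *ᵥ t = Var[fun x => ∑ r, t r * g r x; μ] := by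
  have hL : ∀ r, MemLp (fun x => t r * g r x) 2 μ := fun r => (hg r).const_mul _
  have hS : MemLp (fun x => ∑ r, t r * g r x) 2 μ := memLp_finsetSum _ fun r _ => hL r
  rw [← covariance_self hS.aemeasurable, covariance_fun_sum_left hL hS]
  simp_rw [covariance_fun_sum_right hL (hL _), covariance_const_mul_left,
    covariance_const_mul_right]
  simp only [dotProduct, Matrix.mulVec, covMatrix, Matrix.of_apply, Finset.mul_sum]
  refine Finset.sum_congr rfl fun r _ => Finset.sum_congr rfl fun s _ => ?_
  ring

theorem covMatrix_posSemidef [Fintype ι] {g : ι → α → ℝ} {μ : Measure α}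
    [IsProbabilityMeasure μ] (hg : ∀ r, MemLp (g r) 2 μ) : (covMatrix g μ).PosSemidef := by
  refine Matrix.PosSemidef.of_dotProduct_mulVec_nonneg ?_ fun t => ?_
  · ext r s
    simp [covMatrix, covariance_comm (g r)]
  · simp only [star_trivial]
    rw [dotProduct_covMatrix_mulVec hg]
    exact variance_nonneg _ _

end CovMatrix

/-! ### The multivariate central limit theorem -/

section CLT

variable {ι α Ω : Type*} [Fintype ι] [DecidableEq ι] [MeasurableSpace α] [MeasurableSpace Ω]
  {μ : Measure α} [IsProbabilityMeasure μ] {P : Measure Ω} [IsProbabilityMeasure P]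
  {X : ℕ → Ω → α}

/-- The multivariate central limit theorem. By Lévy's theorem and the Cramér–Wold device it
reduces to the one-dimensional case. -/
theorem tendstoInDistribution_multivariate_clt
    (hlaw : ∀ m, HasLaw (X m) μ P) (hindep : iIndepFun X P)
    {g : ι → α → ℝ} (hgm : ∀ r, Measurable (g r)) (hg : ∀ r, MemLp (g r) 2 μ) :
    TendstoInDistribution
      (fun (n : ℕ) ω => (WithLp.toLp 2 fun r =>
        (√(n : ℝ))⁻¹ * (∑ k ∈ Finset.range n, g r (X k ω) - n * ∫ x, g r x ∂μ) :
          EuclideanSpace ℝ ι))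
      atTop id (fun _ => P) (multivariateGaussian 0 (covMatrix g μ)) := by
  have hXm : ∀ m, AEMeasurable (X m) P := fun m => (hlaw m).aemeasurable
  have hmeas : ∀ n : ℕ, AEMeasurable (fun ω => (WithLp.toLp 2 fun r =>
        (√(n : ℝ))⁻¹ * (∑ k ∈ Finset.range n, g r (X k ω) - n * ∫ x, g r x ∂μ) :
          EuclideanSpace ℝ ι)) P := by
    intro n
    refine (WithLp.measurable_toLp 2 _).comp_aemeasurable (aemeasurable_pi_lambda _ fun r => ?_)
    refine ((Finset.aemeasurable_fun_sum _ fun k _ => ?_).sub_const _).const_mul _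
    exact (hgm r).comp_aemeasurable (hXm k)
  refine ⟨hmeas, by fun_prop, ?_⟩
  refine ProbabilityMeasure.tendsto_iff_tendsto_charFun.2 fun t => ?_
  set f : α → ℝ := fun x => ∑ r, t r * g r x with hf
  have hfm : Measurable f := by fun_prop
  have hfL : MemLp f 2 μ := memLp_finsetSum _ fun r _ => (hg r).const_mul _
  have hident : ∀ i, IdentDistrib (fun ω => f (X i ω)) (fun ω => f (X 0 ω)) P P := fun i =>
    (IdentDistrib.mk (hXm i) (hXm 0) ((hlaw i).map_eq.trans (hlaw 0).map_eq.symm)).comp hfm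
  have hmean : ∫ ω, f (X 0 ω) ∂P = ∫ x, f x ∂μ := by
    rw [← (hlaw 0).map_eq, integral_map (hXm 0) hfm.aestronglyMeasurable]
  have hvar : Var[fun ω => f (X 0 ω); P] = Var[f; μ] := by
    rw [← (hlaw 0).map_eq, variance_map hfm.aemeasurable (hXm 0)]
    rfl
  have hfL0 : MemLp (fun ω => f (X 0 ω)) 2 P := by
    have h := hfL
    rw [← (hlaw 0).map_eq] at h
    exact h.comp_of_map (hXm 0)
  have hclt := tendstoInDistribution_inv_sqrt_mul_sum_sub (P := P)
    (X := fun k ω => f (X k ω)) (Y := id) (P' := gaussianReal 0 (Var[f; μ]).toNNReal)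
    (by rw [hvar]; exact ⟨aemeasurable_id, Measure.map_id⟩) hfL0
    (hindep.comp (fun _ => f) fun _ => hfm) hident
  have hlim := ProbabilityMeasure.tendsto_iff_tendsto_charFun.1 hclt.tendsto 1
  simp only [ProbabilityMeasure.coe_mk, Measure.map_id] at hlim ⊢
  rw [charFun_multivariateGaussian (covMatrix_posSemidef hg), dotProduct_covMatrix_mulVec hg]
  rw [charFun_gaussianReal] at hlim
  have hfint : ∫ x, f x ∂μ = ∑ r, t r * ∫ x, g r x ∂μ := by
    rw [hf, integral_finsetSum _ fun r _ => ((hg r).const_mul _).integrable (by norm_num)]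
    simp_rw [integral_const_mul]
  have hchar : ∀ n : ℕ, charFun (P.map fun ω => (WithLp.toLp 2 fun r =>
        (√(n : ℝ))⁻¹ * (∑ k ∈ Finset.range n, g r (X k ω) - n * ∫ x, g r x ∂μ) :
          EuclideanSpace ℝ ι)) t
      = charFun (P.map fun ω => (√(n : ℝ))⁻¹ *
          (∑ k ∈ Finset.range n, f (X k ω) - n * ∫ ω, f (X 0 ω) ∂P)) 1 := by
    intro n
    rw [charFun_apply, charFun_apply, integral_map (hmeas n) (by fun_prop),
      integral_map (hclt.forall_aemeasurable n) (by fun_prop)]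
    refine integral_congr_ae (Eventually.of_forall fun ω => ?_)
    simp only
    congr 3
    rw [hmean, hfint]
    simp only [PiLp.inner_apply, Real.inner_apply, hf, mul_one]
    rw [Finset.sum_comm, Finset.mul_sum (a := (n : ℝ)), ← Finset.sum_sub_distrib, Finset.mul_sum]
    refine Finset.sum_congr rfl fun r _ => ?_
    rw [← Finset.mul_sum]
    ring
  simp_rw [hchar]
  convert hlim using 2
  rw [Real.coe_toNNReal _ (variance_nonneg _ _)]
  simp [hf]

end CLT

/-! ### Completely degenerate sums over pairs -/

section UStatistic

theorem sum_offDiag_fst {M : Type*} [CommRing M] (n : ℕ) (f : ℕ → M) :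
    ∑ q ∈ (Finset.range n).offDiag, f q.1 = ((n : M) - 1) * ∑ k ∈ Finset.range n, f k := by
  have h : ∑ q ∈ Finset.range n ×ˢ Finset.range n, f q.1 = n * ∑ k ∈ Finset.range n, f k := by
    rw [Finset.sum_product, Finset.mul_sum]
    simp
  rw [← Finset.diag_union_offDiag, Finset.sum_union (Finset.disjoint_diag_offDiag _),
    Finset.sum_diag] at h
  rw [sub_mul, one_mul, ← h]
  ring

theorem sum_offDiag_snd {M : Type*} [CommRing M] (n : ℕ) (f : ℕ → M) :
    ∑ q ∈ (Finset.range n).offDiag, f q.2 = ((n : M) - 1) * ∑ k ∈ Finset.range n, f k := by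
  rw [← sum_offDiag_fst]
  refine Finset.sum_nbij' Prod.swap Prod.swap ?_ ?_ ?_ ?_ ?_ <;> simp +contextual [eq_comm]

variable {ι α Ω : Type*} [MeasurableSpace α] [MeasurableSpace Ω]
  {μ : Measure α} [IsProbabilityMeasure μ] {P : Measure Ω} [IsProbabilityMeasure P]
  {X : ℕ → Ω → α}

/-- An observation `X b` that is independent of all the others entering `F` may be integrated out
first. -/
theorem integral_eq_zero_of_iIndepFun_of_notMem
    (hlaw : ∀ m, HasLaw (X m) μ P) (hindep : iIndepFun X P) {T : Finset ℕ} {b : ℕ} (hb : b ∉ T)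
    {F : (T → α) → α → ℝ} (hF : Measurable (Function.uncurry F)) {M : ℝ}
    (hM : ∀ z y, |F z y| ≤ M) (hF0 : ∀ z, ∫ y, F z y ∂μ = 0) :
    ∫ ω, F (fun i => X i ω) (X b ω) ∂P = 0 := by
  have hXm : ∀ m, AEMeasurable (X m) P := fun m => (hlaw m).aemeasurable
  have hTm : AEMeasurable (fun ω (i : T) => X i ω) P := aemeasurable_pi_lambda _ fun i => hXm i
  have hind : IndepFun (fun ω (i : T) => X i ω) (X b) P :=
    (hindep.indepFun_finset₀ T {b} (by simpa using hb) hXm).comp (φ := id)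
      (ψ := fun z : ({b} : Finset ℕ) → α => z ⟨b, by simp⟩) measurable_id (measurable_pi_apply _)
  have hmap := hind.map_prod_eq_prod_map_map hTm (hXm b)
  rw [(hlaw b).map_eq] at hmap
  have : IsProbabilityMeasure (P.map fun ω (i : T) => X i ω) := Measure.isProbabilityMeasure_map hTm
  have h1 : ∫ ω, F (fun i => X i ω) (X b ω) ∂P
      = ∫ z, Function.uncurry F z ∂(P.map fun ω => ((fun i : T => X i ω), X b ω)) := by
    rw [integral_map (hTm.prodMk (hXm b)) hF.aestronglyMeasurable]
    rfl
  rw [h1, hmap, integral_prod _ (Integrable.of_bound hF.aestronglyMeasurable M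
    (Eventually.of_forall fun z => hM z.1 z.2))]
  simp [hF0]

/-- The second moment of a completely degenerate sum over ordered pairs: two summands are
uncorrelated unless their index pairs agree up to order. -/
theorem integral_sq_sum_degenerate_le
    (hlaw : ∀ m, HasLaw (X m) μ P) (hindep : iIndepFun X P)
    {D : α → α → ℝ} (hD : Measurable (Function.uncurry D)) {M : ℝ} (hM : ∀ x y, |D x y| ≤ M)
    (hD1 : ∀ x, ∫ y, D x y ∂μ = 0) (hD2 : ∀ y, ∫ x, D x y ∂μ = 0) (n : ℕ) :
    ∫ ω, (∑ q ∈ (Finset.range n).offDiag, D (X q.1 ω) (X q.2 ω)) ^ 2 ∂P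
      ≤ 2 * ((Finset.range n).offDiag.card * M ^ 2) := by
  have hXm : ∀ m, AEMeasurable (X m) P := fun m => (hlaw m).aemeasurable
  have hDm : ∀ a b, AEMeasurable (fun ω => D (X a ω) (X b ω)) P := fun a b =>
    hD.comp_aemeasurable ((hXm a).prodMk (hXm b))
  have hbd : ∀ x y x' y', |D x y * D x' y'| ≤ M ^ 2 := fun x y x' y' => by
    rw [abs_mul, pow_two]
    exact mul_le_mul (hM _ _) (hM _ _) (abs_nonneg _) ((abs_nonneg _).trans (hM x y))
  have hint : ∀ q q' : ℕ × ℕ,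
      Integrable (fun ω => D (X q.1 ω) (X q.2 ω) * D (X q'.1 ω) (X q'.2 ω)) P := fun q q' =>
    Integrable.of_bound ((hDm _ _).mul (hDm _ _)).aestronglyMeasurable (M ^ 2)
      (Eventually.of_forall fun ω => hbd _ _ _ _)
  have hzero : ∀ q ∈ (Finset.range n).offDiag, ∀ q' ∈ (Finset.range n).offDiag,
      q' ≠ q → q' ≠ q.swap →
      ∫ ω, D (X q.1 ω) (X q.2 ω) * D (X q'.1 ω) (X q'.2 ω) ∂P = 0 := by
    rintro ⟨a, b⟩ hq ⟨c, e⟩ hq' h1 h2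
    simp only [Finset.mem_offDiag, ne_eq, Prod.mk.injEq, Prod.swap_prod_mk] at hq hq' h1 h2
    -- One of `a`, `b` occurs only once among the four indices: both cannot belong to `{c, e}`.
    by_cases hb : b ∈ ({a, c, e} : Finset ℕ)
    · have ha : a ∉ ({b, c, e} : Finset ℕ) := by
        simp only [Finset.mem_insert, Finset.mem_singleton] at hb ⊢
        omega
      refine integral_eq_zero_of_iIndepFun_of_notMem hlaw hindep ha
        (F := fun z y => D y (z ⟨b, by simp⟩) * D (z ⟨c, by simp⟩) (z ⟨e, by simp⟩)) ?_
        (fun _ _ => hbd _ _ _ _) fun z => ?_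
      · exact (hD.comp (by fun_prop : Measurable fun p : (({b, c, e} : Finset ℕ) → α) × α =>
          (p.2, p.1 ⟨b, _⟩))).mul (hD.comp (by fun_prop :
            Measurable fun p : (({b, c, e} : Finset ℕ) → α) × α =>
              (p.1 ⟨c, _⟩, p.1 ⟨e, _⟩)))
      · rw [integral_mul_const, hD2, zero_mul]
    · refine integral_eq_zero_of_iIndepFun_of_notMem hlaw hindep hb
        (F := fun z y => D (z ⟨a, by simp⟩) y * D (z ⟨c, by simp⟩) (z ⟨e, by simp⟩)) ?_
        (fun _ _ => hbd _ _ _ _) fun z => ?_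
      · exact (hD.comp (by fun_prop : Measurable fun p : (({a, c, e} : Finset ℕ) → α) × α =>
          (p.1 ⟨a, _⟩, p.2))).mul (hD.comp (by fun_prop :
            Measurable fun p : (({a, c, e} : Finset ℕ) → α) × α =>
              (p.1 ⟨c, _⟩, p.1 ⟨e, _⟩)))
      · rw [integral_mul_const, hD1, zero_mul]
  have hle : ∀ q q' : ℕ × ℕ,
      ∫ ω, D (X q.1 ω) (X q.2 ω) * D (X q'.1 ω) (X q'.2 ω) ∂P ≤ M ^ 2 := fun q q' => by
    refine (integral_mono (hint q q') (integrable_const (M ^ 2))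
      fun ω => (le_abs_self _).trans (hbd _ _ _ _)).trans ?_
    simp
  calc ∫ ω, (∑ q ∈ (Finset.range n).offDiag, D (X q.1 ω) (X q.2 ω)) ^ 2 ∂P
      = ∑ q ∈ (Finset.range n).offDiag, ∑ q' ∈ (Finset.range n).offDiag,
          ∫ ω, D (X q.1 ω) (X q.2 ω) * D (X q'.1 ω) (X q'.2 ω) ∂P := by
        simp_rw [pow_two, Finset.sum_mul_sum]
        rw [integral_finsetSum _ fun q _ => integrable_finsetSum _ fun q' _ => hint q q']
        exact Finset.sum_congr rfl fun q _ => integral_finsetSum _ fun q' _ => hint q q'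
    _ ≤ ∑ q ∈ (Finset.range n).offDiag, ∑ q' ∈ ({q, q.swap} : Finset (ℕ × ℕ)), M ^ 2 := by
        refine Finset.sum_le_sum fun q hq => ?_
        have hsub : ({q, q.swap} : Finset (ℕ × ℕ)) ⊆ (Finset.range n).offDiag := by
          simp only [Finset.mem_offDiag] at hq
          intro q' hq'
          simp only [Finset.mem_insert, Finset.mem_singleton] at hq'
          rcases hq' with rfl | rfl <;> simp_all [eq_comm]
        rw [← Finset.sum_subset hsub fun q' hq' hn => ?_]
        · exact Finset.sum_le_sum fun q' _ => hle q q'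
        · simp only [Finset.mem_insert, Finset.mem_singleton, not_or] at hn
          exact hzero q hq q' hq' hn.1 hn.2
    _ ≤ 2 * ((Finset.range n).offDiag.card * M ^ 2) := by
        simp only [Finset.sum_const, nsmul_eq_mul]
        rw [mul_left_comm]
        rw [← nsmul_eq_mul, ← Finset.sum_const]
        refine (Finset.sum_le_sum fun q _ => ?_).trans_eq (by rw [Finset.sum_const, nsmul_eq_mul])
        exact mul_le_mul_of_nonneg_right (by exact_mod_cast Finset.card_le_two) (sq_nonneg M)

end UStatistic

/-! ### The central limit theorem for U-statistics -/

section UStatisticCLT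

variable {ι α Ω : Type*} [MeasurableSpace α] [MeasurableSpace Ω]
  {μ : Measure α} [IsProbabilityMeasure μ] {P : Measure Ω} [IsProbabilityMeasure P]
  {X : ℕ → Ω → α}

/-- The U-statistic `(n (n - 1))⁻¹ ∑_{a ≠ b} h (x_a, x_b)` of order two; it is
`0` for `n ≤ 1`, the sum being empty. -/
noncomputable def uStatistic (h : α → α → ℝ) (n : ℕ) (x : ℕ → α) : ℝ :=
  1 / ((n : ℝ) * ((n : ℝ) - 1)) * ∑ q ∈ (Finset.range n).offDiag, h (x q.1) (x q.2)

/-- The sum `x ↦ E h(x, Y) + E h(Y, x)` of the two first-order projections of the kernel `h`. -/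
noncomputable def hajekProjection (h : α → α → ℝ) (μ : Measure α) (x : α) : ℝ :=
  ∫ y, h x y ∂μ + ∫ y, h y x ∂μ

/-- The completely degenerate part of the kernel `h` in its Hoeffding decomposition. -/
noncomputable def degeneratePart (h : α → α → ℝ) (μ : Measure α) (x y : α) : ℝ :=
  h x y - ∫ z, h x z ∂μ - ∫ z, h z y ∂μ + ∫ x, ∫ y, h x y ∂μ ∂μ

section Kernel

variable {h : α → α → ℝ} (hm : Measurable (Function.uncurry h)) {M : ℝ} (hM : ∀ x y, |h x y| ≤ M)

include hm

theorem measurable_integral_kernel_snd : Measurable fun x => ∫ y, h x y ∂μ :=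
  (hm.stronglyMeasurable.integral_prod_right (f := h) (ν := μ)).measurable

theorem measurable_integral_kernel_fst : Measurable fun y => ∫ x, h x y ∂μ :=
  measurable_integral_kernel_snd (h := fun y x => h x y) (hm.comp measurable_swap)

theorem measurable_hajekProjection : Measurable (hajekProjection h μ) :=
  (measurable_integral_kernel_snd hm).add (measurable_integral_kernel_fst hm)

theorem measurable_degeneratePart : Measurable (Function.uncurry (degeneratePart h μ)) :=
  ((hm.sub ((measurable_integral_kernel_snd hm).comp measurable_fst)).sub
    ((measurable_integral_kernel_fst hm).comp measurable_snd)).add_const _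

omit hm
include hM

theorem abs_integral_kernel_snd_le (x : α) : |∫ y, h x y ∂μ| ≤ M := by
  simpa using norm_integral_le_of_norm_le_const (μ := μ) (f := h x) (Eventually.of_forall (hM x))

theorem abs_integral_kernel_fst_le (y : α) : |∫ x, h x y ∂μ| ≤ M :=
  abs_integral_kernel_snd_le (h := fun y x => h x y) (fun x y => hM y x) y

theorem abs_hajekProjection_le (x : α) : |hajekProjection h μ x| ≤ 2 * M := by
  rw [two_mul]
  exact (abs_add_le _ _).trans
    (add_le_add (abs_integral_kernel_snd_le hM x) (abs_integral_kernel_fst_le hM x))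

theorem abs_degeneratePart_le (x y : α) : |degeneratePart h μ x y| ≤ 4 * M := by
  have h1 := abs_le.1 (hM x y)
  have h2 := abs_le.1 (abs_integral_kernel_snd_le (μ := μ) hM x)
  have h3 := abs_le.1 (abs_integral_kernel_fst_le (μ := μ) hM y)
  have h4 : |∫ x, ∫ y, h x y ∂μ ∂μ| ≤ M := by
    simpa using norm_integral_le_of_norm_le_const (μ := μ) (f := fun x => ∫ y, h x y ∂μ)
      (Eventually.of_forall (abs_integral_kernel_snd_le hM))
  have h4 := abs_le.1 h4
  rw [degeneratePart, abs_le]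
  constructor <;> linarith

include hm

theorem integrable_kernel_snd (x : α) : Integrable (h x) μ :=
  .of_bound (hm.of_uncurry_left).aestronglyMeasurable M (Eventually.of_forall fun y => hM x y)

theorem integrable_kernel_fst (y : α) : Integrable (fun x => h x y) μ :=
  integrable_kernel_snd (h := fun y x => h x y) (hm.comp measurable_swap) (fun x y => hM y x) y

theorem integrable_integral_kernel_snd : Integrable (fun x => ∫ y, h x y ∂μ) μ :=
  .of_bound (measurable_integral_kernel_snd hm).aestronglyMeasurable M
    (Eventually.of_forall (abs_integral_kernel_snd_le hM))

theorem integrable_integral_kernel_fst : Integrable (fun y => ∫ x, h x y ∂μ) μ :=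
  .of_bound (measurable_integral_kernel_fst hm).aestronglyMeasurable M
    (Eventually.of_forall (abs_integral_kernel_fst_le hM))

theorem integral_integral_kernel_swap :
    ∫ y, ∫ x, h x y ∂μ ∂μ = ∫ x, ∫ y, h x y ∂μ ∂μ :=
  (integral_integral_swap (Integrable.of_bound hm.aestronglyMeasurable M
    (Eventually.of_forall fun z => hM z.1 z.2))).symm

theorem memLp_hajekProjection : MemLp (hajekProjection h μ) 2 μ :=
  .of_bound (measurable_hajekProjection hm).aestronglyMeasurable (2 * M)
    (Eventually.of_forall (abs_hajekProjection_le hM))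

theorem integral_hajekProjection :
    ∫ x, hajekProjection h μ x ∂μ = 2 * ∫ x, ∫ y, h x y ∂μ ∂μ := by
  simp only [hajekProjection]
  rw [integral_add (integrable_integral_kernel_snd hm hM) (integrable_integral_kernel_fst hm hM),
    integral_integral_kernel_swap hm hM, two_mul]

theorem integral_degeneratePart_snd (x : α) : ∫ y, degeneratePart h μ x y ∂μ = 0 := by
  simp only [degeneratePart]
  have h1 : Integrable (fun y => h x y) μ := integrable_kernel_snd hm hM x
  have h2 : Integrable (fun y => ∫ x, h x y ∂μ) μ := integrable_integral_kernel_fst hm hM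
  have h3 : Integrable (fun y => h x y - ∫ z, h x z ∂μ) μ := h1.sub (integrable_const _)
  rw [integral_add (f := fun y => h x y - ∫ z, h x z ∂μ - ∫ z, h z y ∂μ) (h3.sub h2)
    (integrable_const _), integral_sub h3 h2, integral_sub h1 (integrable_const _),
    integral_integral_kernel_swap hm hM]
  simp

theorem integral_degeneratePart_fst (y : α) : ∫ x, degeneratePart h μ x y ∂μ = 0 := by
  simp only [degeneratePart]
  have h1 : Integrable (fun x => h x y) μ := integrable_kernel_fst hm hM y
  have h2 : Integrable (fun x => ∫ y, h x y ∂μ) μ := integrable_integral_kernel_snd hm hM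
  have h3 : Integrable (fun x => h x y - ∫ z, h x z ∂μ) μ := h1.sub h2
  rw [integral_add (f := fun x => h x y - ∫ z, h x z ∂μ - ∫ z, h z y ∂μ)
    (h3.sub (integrable_const _)) (integrable_const _),
    integral_sub h3 (integrable_const _), integral_sub h1 h2]
  simp

end Kernel

omit [IsProbabilityMeasure μ] in
/-- Hoeffding decomposition: the linear part of the centred and scaled U-statistic plus a
completely degenerate remainder. -/
theorem sqrt_mul_uStatistic_sub (h : α → α → ℝ) (x : ℕ → α) {n : ℕ} (hn : 2 ≤ n) :
    √(n : ℝ) * (uStatistic h n x - ∫ x, ∫ y, h x y ∂μ ∂μ)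
      - (√(n : ℝ))⁻¹ * (∑ k ∈ Finset.range n, hajekProjection h μ (x k)
          - n * (2 * ∫ x, ∫ y, h x y ∂μ ∂μ))
      = √(n : ℝ) / (n * (n - 1)) *
          ∑ q ∈ (Finset.range n).offDiag, degeneratePart h μ (x q.1) (x q.2) := by
  have hn0 : (n : ℝ) ≠ 0 := by positivity
  have hn1 : (n : ℝ) - 1 ≠ 0 := by
    have : (2 : ℝ) ≤ n := by exact_mod_cast hn
    linarith
  have hcard : ∑ _q ∈ (Finset.range n).offDiag, (1 : ℝ) = (n - 1) * n := by
    simpa using sum_offDiag_fst (M := ℝ) n fun _ => 1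
  have hsum : ∑ q ∈ (Finset.range n).offDiag, degeneratePart h μ (x q.1) (x q.2)
      = ∑ q ∈ (Finset.range n).offDiag, h (x q.1) (x q.2)
        - (n - 1) * ∑ k ∈ Finset.range n, ∫ z, h (x k) z ∂μ
        - (n - 1) * ∑ k ∈ Finset.range n, ∫ z, h z (x k) ∂μ
        + (∫ x, ∫ y, h x y ∂μ ∂μ) * ((n - 1) * n) := by
    simp only [degeneratePart]
    rw [Finset.sum_add_distrib, Finset.sum_sub_distrib, Finset.sum_sub_distrib,
      sum_offDiag_fst n fun k => ∫ z, h (x k) z ∂μ, sum_offDiag_snd n fun k => ∫ z, h z (x k) ∂μ,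
      ← hcard, Finset.mul_sum (s := (Finset.range n).offDiag), mul_one]
  simp only [uStatistic, hajekProjection]
  rw [hsum, Finset.sum_add_distrib]
  have hs : (√(n : ℝ))⁻¹ = √(n : ℝ) / n := by
    rw [inv_eq_one_div, eq_comm, Real.sqrt_div_self']
  rw [hs]
  field_simp
  ring

theorem integral_sq_sqrt_mul_sum_degeneratePart_le
    (hlaw : ∀ m, HasLaw (X m) μ P) (hindep : iIndepFun X P) {h : α → α → ℝ}
    (hm : Measurable (Function.uncurry h)) {M : ℝ} (hM : ∀ x y, |h x y| ≤ M) {n : ℕ}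
    (hn : 2 ≤ n) :
    ∫ ω, (√(n : ℝ) / (n * (n - 1)) *
          ∑ q ∈ (Finset.range n).offDiag, degeneratePart h μ (X q.1 ω) (X q.2 ω)) ^ 2 ∂P
      ≤ 2 * (4 * M) ^ 2 / (n - 1) := by
  have hn2 : (2 : ℝ) ≤ n := by exact_mod_cast hn
  have hn1 : (0 : ℝ) < (n : ℝ) - 1 := by linarith
  have hcard : ((Finset.range n).offDiag.card : ℝ) = (n - 1) * n := by
    simpa using sum_offDiag_fst (M := ℝ) n fun _ => 1
  have hle := integral_sq_sum_degenerate_le hlaw hindep (measurable_degeneratePart (μ := μ) hm)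
    (abs_degeneratePart_le hM) (integral_degeneratePart_snd hm hM)
    (integral_degeneratePart_fst hm hM) n
  simp_rw [mul_pow _ (Finset.sum _ _)]
  rw [integral_const_mul]
  refine (mul_le_mul_of_nonneg_left hle (sq_nonneg _)).trans_eq ?_
  rw [hcard, div_pow, Real.sq_sqrt (by positivity)]
  field_simp

/-- Coordinatewise convergence to zero in `L²` implies convergence in measure; the identification of
the coordinates is only needed for large `n`. -/
theorem tendstoInMeasure_zero_of_integral_sq_le [Fintype ι]
    {Z : ℕ → Ω → EuclideanSpace ℝ ι} {R : ι → ℕ → Ω → ℝ} {c : ℕ → ℝ}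
    (hc : Tendsto c atTop (𝓝 0)) (hint : ∀ r n, Integrable (fun ω => R r n ω ^ 2) P)
    (hZ : ∀ᶠ n in atTop, ∀ ω r, Z n ω r = R r n ω)
    (hle : ∀ᶠ n in atTop, ∀ r, ∫ ω, R r n ω ^ 2 ∂P ≤ c n) :
    TendstoInMeasure P Z atTop 0 := by
  rw [tendstoInMeasure_iff_measureReal_norm]
  intro ε hε
  have hlim : Tendsto (fun n : ℕ => (∑ _r : ι, c n) / ε ^ 2) atTop (𝓝 0) := by
    simpa using (tendsto_finsetSum Finset.univ fun (_ : ι) _ => hc).div_const (ε ^ 2)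
  refine tendsto_of_tendsto_of_tendsto_of_le_of_le' tendsto_const_nhds hlim
    (Eventually.of_forall fun n => measureReal_nonneg) ?_
  filter_upwards [hZ, hle] with n hn hn'
  rw [le_div_iff₀ (by positivity), mul_comm]
  have hmark := mul_meas_ge_le_integral_of_nonneg (μ := P) (f := fun ω => ∑ r, R r n ω ^ 2)
    (Eventually.of_forall fun ω => Finset.sum_nonneg fun r _ => sq_nonneg _)
    (integrable_finsetSum _ fun r _ => hint r n) (ε ^ 2)
  rw [integral_finsetSum _ fun r _ => hint r n] at hmark
  refine le_trans (le_of_eq ?_) (hmark.trans (Finset.sum_le_sum fun r _ => hn' r))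
  congr 2
  ext ω
  simp only [Set.mem_ofPred_eq, Pi.zero_apply, sub_zero]
  simp_rw [← hn ω]
  rw [← EuclideanSpace.real_norm_sq_eq, pow_le_pow_iff_left₀ hε.le (norm_nonneg _) two_ne_zero]

theorem integrable_sq_sqrt_mul_sum_degeneratePart
    (hlaw : ∀ m, HasLaw (X m) μ P) {h : α → α → ℝ}
    (hm : Measurable (Function.uncurry h)) {M : ℝ} (hM : ∀ x y, |h x y| ≤ M) (n : ℕ) :
    Integrable (fun ω => (√(n : ℝ) / (n * (n - 1)) *
      ∑ q ∈ (Finset.range n).offDiag, degeneratePart h μ (X q.1 ω) (X q.2 ω)) ^ 2) P := by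
  have hXm : ∀ m, AEMeasurable (X m) P := fun m => (hlaw m).aemeasurable
  have hterm : ∀ q : ℕ × ℕ, MemLp (fun ω => degeneratePart h μ (X q.1 ω) (X q.2 ω)) 2 P :=
    fun q => MemLp.of_bound ((measurable_degeneratePart hm).comp_aemeasurable
      ((hXm q.1).prodMk (hXm q.2))).aestronglyMeasurable (4 * M)
      (Eventually.of_forall fun ω => abs_degeneratePart_le hM _ _)
  exact ((memLp_finsetSum _ fun q _ => hterm q).const_mul _).integrable_sq

/-- The central limit theorem for a vector of U-statistics of order two with bounded kernels.
The linear part obeys the multivariate central limit theorem; the degenerate remainder has second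
moment `O(1 / n)` and is removed by Slutsky's theorem. -/
theorem tendstoInDistribution_uStatistic [Fintype ι] [DecidableEq ι]
    (hlaw : ∀ m, HasLaw (X m) μ P) (hindep : iIndepFun X P) {h : ι → α → α → ℝ}
    (hm : ∀ r, Measurable (Function.uncurry (h r))) {M : ℝ} (hM : ∀ r x y, |h r x y| ≤ M) :
    TendstoInDistribution
      (fun (n : ℕ) ω => (WithLp.toLp 2 fun r =>
        √(n : ℝ) * (uStatistic (h r) n (fun m => X m ω) - ∫ x, ∫ y, h r x y ∂μ ∂μ) :
          EuclideanSpace ℝ ι))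
      atTop id (fun _ => P)
      (multivariateGaussian 0 (covMatrix (fun r => hajekProjection (h r) μ) μ)) := by
  have hXm : ∀ m, AEMeasurable (X m) P := fun m => (hlaw m).aemeasurable
  have hclt := tendstoInDistribution_multivariate_clt hlaw hindep
    (fun r => measurable_hajekProjection (μ := μ) (hm r))
    (fun r => memLp_hajekProjection (hm r) (hM r))
  refine tendstoInDistribution_of_tendstoInMeasure_sub _ _ hclt ?_ fun n => ?_
  swap
  · refine (WithLp.measurable_toLp 2 _).comp_aemeasurable (aemeasurable_pi_lambda _ fun r => ?_)
    refine (((Finset.aemeasurable_fun_sum _ fun q _ => ?_).const_mul _).sub_const _).const_mul _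
    exact (hm r).comp_aemeasurable ((hXm q.1).prodMk (hXm q.2))
  have hlim : Tendsto (fun n : ℕ => 2 * (4 * M) ^ 2 / ((n : ℝ) - 1)) atTop (𝓝 0) :=
    Tendsto.div_atTop tendsto_const_nhds
      (tendsto_atTop_add_const_right _ _ tendsto_natCast_atTop_atTop)
  refine tendstoInMeasure_zero_of_integral_sq_le hlim
    (fun r n => integrable_sq_sqrt_mul_sum_degeneratePart hlaw (hm r) (hM r) n) ?_ ?_
  · filter_upwards [eventually_ge_atTop 2] with n hn ω r
    rw [← sqrt_mul_uStatistic_sub (μ := μ) (h r) (fun m => X m ω) hn,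
      ← integral_hajekProjection (hm r) (hM r)]
    rfl
  · filter_upwards [eventually_ge_atTop 2] with n hn r
    exact integral_sq_sqrt_mul_sum_degeneratePart_le hlaw hindep (hm r) (hM r) hn

end UStatisticCLT

/-! ### Continuous distribution functions -/

section ContinuousCDF

theorem nullSingletonClass_of_continuous_cdf {ν : Measure ℝ} [IsProbabilityMeasure ν]
    (hc : Continuous (cdf ν)) : NullSingletonClass ν := by
  refine ⟨fun a => ?_⟩
  rw [← measure_cdf ν, StieltjesFunction.measure_singleton, hc.continuousWithinAt.leftLim_eq, sub_self,
    ENNReal.ofReal_zero]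

/-- Applying a continuous distribution function preserves the order up to null sets. The sublevel
set `{F ≤ F x}` is either the whole line or a half-line `Iic z` with `F z ≤ F x`, so it has the same
mass as `Iic x`. -/
theorem ae_cdf_le_cdf_iff {ν : Measure ℝ} [IsProbabilityMeasure ν]
    (hc : Continuous (cdf ν)) (x : ℝ) : ∀ᵐ y ∂ν, cdf ν y ≤ cdf ν x ↔ y ≤ x := by
  set S : Set ℝ := {y | cdf ν y ≤ cdf ν x} with hS
  have hsub : Set.Iic x ⊆ S := fun y hy => monotone_cdf ν hy
  have hclosed : IsClosed S := isClosed_le hc continuous_const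
  have hle : ν S ≤ ν (Set.Iic x) := by
    by_cases hb : BddAbove S
    · have hz : sSup S ∈ S := hclosed.csSup_mem ⟨x, hsub Set.self_mem_Iic⟩ hb
      calc ν S ≤ ν (Set.Iic (sSup S)) := measure_mono fun y hy => le_csSup hb hy
        _ = ENNReal.ofReal (cdf ν (sSup S)) := (ofReal_cdf ν _).symm
        _ ≤ ENNReal.ofReal (cdf ν x) := ENNReal.ofReal_le_ofReal hz
        _ = ν (Set.Iic x) := ofReal_cdf ν x
    · have hall : ∀ y, cdf ν y ≤ cdf ν x := fun y => by
        obtain ⟨z, hz, hyz⟩ := not_bddAbove_iff.1 hb y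
        exact (monotone_cdf ν hyz.le).trans hz
      have h1 : (1 : ℝ) ≤ cdf ν x :=
        le_of_tendsto (tendsto_cdf_atTop ν) (Eventually.of_forall hall)
      rw [← ofReal_cdf ν x]
      exact prob_le_one.trans (by simpa using h1)
  have hae : (Set.Iic x : Set ℝ) =ᵐ[ν] S :=
    ae_eq_of_subset_of_measure_ge hsub hle measurableSet_Iic.nullMeasurableSet
      (measure_ne_top ν S)
  filter_upwards [hae.mem_iff] with y hy
  exact hy.symm

end ContinuousCDF

/-! ### Kendall's tau as a U-statistic -/

section Kendall

variable {d : ℕ} {μ : Measure (Fin d → ℝ)} [IsProbabilityMeasure μ]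

theorem isProbabilityMeasure_map_eval (j : Fin d) : IsProbabilityMeasure (μ.map fun x => x j) :=
  Measure.isProbabilityMeasure_map (measurable_pi_apply j).aemeasurable

instance isProbabilityMeasure_copulaLaw : IsProbabilityMeasure (copulaLaw μ) :=
  Measure.isProbabilityMeasure_map (measurable_probTransform μ).aemeasurable

theorem ae_ne_of_continuous_marginalCDF {j : Fin d} (hc : Continuous (marginalCDF μ j)) (t : ℝ) :
    ∀ᵐ y ∂μ, y j ≠ t := by
  have := isProbabilityMeasure_map_eval (μ := μ) j
  have := nullSingletonClass_of_continuous_cdf (ν := μ.map fun x : Fin d → ℝ => x j) hc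
  exact ae_of_ae_map (p := fun s => s ≠ t) (f := fun x : Fin d → ℝ => x j)
    (measurable_pi_apply j).aemeasurable (Measure.ae_ne _ t)

theorem ae_marginalCDF_le_iff {j : Fin d} (hc : Continuous (marginalCDF μ j)) (t : ℝ) :
    ∀ᵐ y ∂μ, marginalCDF μ j (y j) ≤ marginalCDF μ j t ↔ y j ≤ t := by
  have := isProbabilityMeasure_map_eval (μ := μ) j
  exact ae_of_ae_map (p := fun s => marginalCDF μ j s ≤ marginalCDF μ j t ↔ s ≤ t)
    (f := fun x : Fin d → ℝ => x j) (measurable_pi_apply j).aemeasurable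
    (ae_cdf_le_cdf_iff (ν := μ.map fun x : Fin d → ℝ => x j) hc t)

theorem pairCopula_marginalCDF (hcont : ∀ j, Continuous (marginalCDF μ j)) (i j : Fin d)
    (x : Fin d → ℝ) :
    pairCopula μ i j (probTransform μ x i) (probTransform μ x j)
      = μ.real {y | y i ≤ x i ∧ y j ≤ x j} := by
  have hm : MeasurableSet {v : Fin d → ℝ |
      v i ≤ probTransform μ x i ∧ v j ≤ probTransform μ x j} :=
    (measurableSet_le (measurable_pi_apply i) measurable_const).inter
      (measurableSet_le (measurable_pi_apply j) measurable_const)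
  rw [pairCopula, copulaLaw, map_measureReal_apply (measurable_probTransform μ) hm]
  refine measureReal_congr ?_
  filter_upwards [ae_marginalCDF_le_iff (hcont i) (x i), ae_marginalCDF_le_iff (hcont j) (x j)]
    with y h1 h2
  exact propext (and_congr h1 h2)

theorem pairSurvival_marginalCDF (hcont : ∀ j, Continuous (marginalCDF μ j)) (i j : Fin d)
    (x : Fin d → ℝ) :
    pairSurvival μ i j (probTransform μ x i) (probTransform μ x j)
      = μ.real {y | x i ≤ y i ∧ x j ≤ y j} := by
  have hm : MeasurableSet {v : Fin d → ℝ |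
      probTransform μ x i < v i ∧ probTransform μ x j < v j} :=
    (measurableSet_lt measurable_const (measurable_pi_apply i)).inter
      (measurableSet_lt measurable_const (measurable_pi_apply j))
  rw [pairSurvival, copulaLaw, map_measureReal_apply (measurable_probTransform μ) hm]
  refine measureReal_congr ?_
  have key : ∀ k, ∀ᵐ y ∂μ, probTransform μ x k < probTransform μ y k ↔ x k ≤ y k := fun k => by
    filter_upwards [ae_marginalCDF_le_iff (hcont k) (x k),
      ae_ne_of_continuous_marginalCDF (hcont k) (x k)] with y h1 h2
    exact (not_le.symm.trans (not_congr h1)).trans (not_le.trans h2.symm.le_iff_lt.symm)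
  filter_upwards [key i, key j] with y h1 h2
  exact propext (and_congr h1 h2)

theorem measurableSet_le_and_le (i j : Fin d) :
    MeasurableSet {p : (Fin d → ℝ) × (Fin d → ℝ) | p.1 i ≤ p.2 i ∧ p.1 j ≤ p.2 j} := by
  have h : ∀ k, MeasurableSet {p : (Fin d → ℝ) × (Fin d → ℝ) | p.1 k ≤ p.2 k} := fun k =>
    measurableSet_le (by fun_prop) (by fun_prop)
  exact (h i).inter (h j)

theorem measurableSet_lt_and_lt (i j : Fin d) :
    MeasurableSet {p : (Fin d → ℝ) × (Fin d → ℝ) | p.1 i < p.2 i ∧ p.1 j < p.2 j} := by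
  have h : ∀ k, MeasurableSet {p : (Fin d → ℝ) × (Fin d → ℝ) | p.1 k < p.2 k} := fun k =>
    measurableSet_lt (by fun_prop) (by fun_prop)
  exact (h i).inter (h j)

theorem measurable_pairCopula (i j : Fin d) :
    Measurable fun v : Fin d → ℝ => pairCopula μ i j (v i) (v j) :=
  (measurable_measure_prodMk_left (ν := copulaLaw μ)
    (measurable_swap (measurableSet_le_and_le i j))).ennreal_toReal

theorem measurable_pairSurvival (i j : Fin d) :
    Measurable fun v : Fin d → ℝ => pairSurvival μ i j (v i) (v j) :=
  (measurable_measure_prodMk_left (ν := copulaLaw μ)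
    (measurableSet_lt_and_lt i j)).ennreal_toReal

/-- The kernel `4 · 1(x_i ≤ y_i) 1(x_j ≤ y_j)`, whose U-statistic is `1 + T̂_{ij}`. -/
noncomputable def kendallKernel (i j : Fin d) (x y : Fin d → ℝ) : ℝ :=
  4 * ((if x i ≤ y i then (1 : ℝ) else 0) * (if x j ≤ y j then (1 : ℝ) else 0))

theorem kendallKernel_eq_indicator (i j : Fin d) (x y : Fin d → ℝ) :
    kendallKernel i j x y
      = 4 * {p : (Fin d → ℝ) × (Fin d → ℝ) | p.1 i ≤ p.2 i ∧ p.1 j ≤ p.2 j}.indicator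
        (fun _ => (1 : ℝ)) (x, y) := by
  by_cases h1 : x i ≤ y i <;> by_cases h2 : x j ≤ y j <;> simp [kendallKernel, h1, h2]

theorem measurable_kendallKernel (i j : Fin d) :
    Measurable (Function.uncurry (kendallKernel i j)) := by
  have h : Function.uncurry (kendallKernel i j) = fun p => 4 *
      {p : (Fin d → ℝ) × (Fin d → ℝ) | p.1 i ≤ p.2 i ∧ p.1 j ≤ p.2 j}.indicator
        (fun _ => (1 : ℝ)) p := by
    ext p
    exact kendallKernel_eq_indicator i j p.1 p.2
  rw [h]
  exact (measurable_const.indicator (measurableSet_le_and_le i j)).const_mul 4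

theorem abs_kendallKernel_le (i j : Fin d) (x y : Fin d → ℝ) : |kendallKernel i j x y| ≤ 4 := by
  rw [kendallKernel]
  split_ifs <;> norm_num

omit [IsProbabilityMeasure μ] in
theorem integral_kendallKernel_snd (i j : Fin d) (x : Fin d → ℝ) :
    ∫ y, kendallKernel i j x y ∂μ = 4 * μ.real {y | x i ≤ y i ∧ x j ≤ y j} := by
  simp_rw [kendallKernel_eq_indicator, integral_const_mul]
  congr 1
  exact integral_indicator_one (measurable_prodMk_left (measurableSet_le_and_le i j))

omit [IsProbabilityMeasure μ] in
theorem integral_kendallKernel_fst (i j : Fin d) (y : Fin d → ℝ) :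
    ∫ x, kendallKernel i j x y ∂μ = 4 * μ.real {x | x i ≤ y i ∧ x j ≤ y j} := by
  simp_rw [kendallKernel_eq_indicator, integral_const_mul]
  congr 1
  exact integral_indicator_one (measurable_prodMk_right (measurableSet_le_and_le i j))

/-- The projection of the Kendall kernel at `X` is four times the score `C_{ij} + C̄_{ij}` at the
transformed vector `U`, whence the factor `16` in `Σ_∞`. -/
theorem hajekProjection_kendallKernel (hcont : ∀ j, Continuous (marginalCDF μ j)) (i j : Fin d)
    (x : Fin d → ℝ) :
    hajekProjection (kendallKernel i j) μ x
      = 4 * (pairCopula μ i j (probTransform μ x i) (probTransform μ x j)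
          + pairSurvival μ i j (probTransform μ x i) (probTransform μ x j)) := by
  rw [hajekProjection, integral_kendallKernel_snd, integral_kendallKernel_fst,
    pairCopula_marginalCDF hcont, pairSurvival_marginalCDF hcont]
  ring

theorem covMatrix_kendallKernel (hcont : ∀ j, Continuous (marginalCDF μ j)) :
    covMatrix (fun r : UpperPair d => hajekProjection (kendallKernel r.1.1 r.1.2) μ) μ
      = asymptoticCov μ := by
  ext r s
  simp only [covMatrix, asymptoticCov, Matrix.of_apply, copulaLaw]
  have hmeas : ∀ i j : Fin d, Measurable fun v : Fin d → ℝ =>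
      pairCopula μ i j (v i) (v j) + pairSurvival μ i j (v i) (v j) := fun i j =>
    (measurable_pairCopula i j).add (measurable_pairSurvival i j)
  rw [covariance_map (hmeas _ _).aestronglyMeasurable (hmeas _ _).aestronglyMeasurable
    (measurable_probTransform μ).aemeasurable]
  have h : ∀ r : UpperPair d, hajekProjection (kendallKernel r.1.1 r.1.2) μ = fun x => 4 *
      ((fun v : Fin d → ℝ => pairCopula μ r.1.1 r.1.2 (v r.1.1) (v r.1.2)
        + pairSurvival μ r.1.1 r.1.2 (v r.1.1) (v r.1.2)) ∘ probTransform μ) x := fun r => by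
    ext x
    exact hajekProjection_kendallKernel hcont _ _ x
  rw [h, h, covariance_const_mul_left, covariance_const_mul_right]
  ring

/-- Ties being null, discordance is the complement of concordance, and concordance is the disjoint
union of `X ≤ X*` and `X* ≤ X`, which are exchanged by swapping the two copies. -/
theorem kendallMatrix_eq_integral_kendallKernel (hcont : ∀ j, Continuous (marginalCDF μ j))
    (i j : Fin d) :
    kendallMatrix μ i j = -1 + ∫ x, ∫ y, kendallKernel i j x y ∂μ ∂μ := by
  set A : Set ((Fin d → ℝ) × (Fin d → ℝ)) := {p | p.1 i ≤ p.2 i ∧ p.1 j ≤ p.2 j} with hA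
  have hAm : MeasurableSet A := measurableSet_le_and_le i j
  have hint : ∫ x, ∫ y, kendallKernel i j x y ∂μ ∂μ = 4 * (μ.prod μ).real A := by
    rw [integral_integral (f := kendallKernel i j) (Integrable.of_bound
      (measurable_kendallKernel i j).aestronglyMeasurable 4
      (Eventually.of_forall fun z => abs_kendallKernel_le i j z.1 z.2))]
    simp_rw [kendallKernel_eq_indicator, integral_const_mul]
    congr 1
    exact integral_indicator_one hAm
  have hswap : (μ.prod μ).real (Prod.swap ⁻¹' A) = (μ.prod μ).real A := by
    rw [← map_measureReal_apply measurable_swap hAm, Measure.prod_swap]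
  have hne : ∀ k, ∀ᵐ z ∂μ.prod μ, z.1 k ≠ z.2 k := fun k => by
    have hms : MeasurableSet {z : (Fin d → ℝ) × (Fin d → ℝ) | z.1 k ≠ z.2 k} :=
      (measurableSet_eq_fun (by fun_prop) (by fun_prop)).compl
    rw [Measure.ae_prod_iff_ae_ae hms]
    refine Eventually.of_forall fun x => ?_
    filter_upwards [ae_ne_of_continuous_marginalCDF (hcont k) (x k)] with y hy
    exact hy.symm
  have hdisj : AEDisjoint (μ.prod μ) A (Prod.swap ⁻¹' A) := by
    refine measure_eq_zero_iff_ae_notMem.2 ?_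
    filter_upwards [hne i] with z hz hmem
    exact hz (le_antisymm hmem.1.1 hmem.2.1)
  have hm' : MeasurableSet (Prod.swap ⁻¹' A) := measurable_swap hAm
  have hunion : (μ.prod μ).real (A ∪ Prod.swap ⁻¹' A) = 2 * (μ.prod μ).real A := by
    rw [measureReal_union₀ hm'.nullMeasurableSet hdisj, hswap, two_mul]
  have hpos : (μ.prod μ).real {z | 0 < (z.1 i - z.2 i) * (z.1 j - z.2 j)}
      = (μ.prod μ).real (A ∪ Prod.swap ⁻¹' A) := by
    refine measureReal_congr ?_
    filter_upwards [hne i, hne j] with z hi hj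
    refine propext ?_
    change 0 < (z.1 i - z.2 i) * (z.1 j - z.2 j) ↔
      (z.1 i ≤ z.2 i ∧ z.1 j ≤ z.2 j) ∨ (z.2 i ≤ z.1 i ∧ z.2 j ≤ z.1 j)
    rw [mul_pos_iff, sub_pos, sub_pos, sub_neg, sub_neg, or_comm, hi.le_iff_lt, hj.le_iff_lt,
      hi.symm.le_iff_lt, hj.symm.le_iff_lt]
  have hneg : (μ.prod μ).real {z | (z.1 i - z.2 i) * (z.1 j - z.2 j) < 0}
      = (μ.prod μ).real {z | 0 < (z.1 i - z.2 i) * (z.1 j - z.2 j)}ᶜ := by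
    refine measureReal_congr ?_
    filter_upwards [hne i, hne j] with z hi hj
    refine propext ?_
    change (z.1 i - z.2 i) * (z.1 j - z.2 j) < 0 ↔ ¬ 0 < (z.1 i - z.2 i) * (z.1 j - z.2 j)
    rw [not_lt]
    exact ((mul_ne_zero (sub_ne_zero.2 hi) (sub_ne_zero.2 hj)).le_iff_lt).symm
  have hmp : MeasurableSet {z : (Fin d → ℝ) × (Fin d → ℝ) |
      0 < (z.1 i - z.2 i) * (z.1 j - z.2 j)} :=
    measurableSet_lt measurable_const (by fun_prop)
  simp only [kendallMatrix, Matrix.of_apply]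
  rw [hneg, probReal_compl_eq_one_sub hmp, hpos, hunion, hint]
  ring

/-- Kendall's tau depends on the law of `X` only through its copula. -/
theorem kendallMatrix_eq_integral_pairCopula (hcont : ∀ j, Continuous (marginalCDF μ j))
    (i j : Fin d) :
    kendallMatrix μ i j = -1 + 4 * ∫ v, pairCopula μ i j (v i) (v j) ∂copulaLaw μ := by
  rw [kendallMatrix_eq_integral_kendallKernel hcont, ← integral_integral_kernel_swap
    (measurable_kendallKernel i j) (abs_kendallKernel_le i j), copulaLaw, integral_map
    (measurable_probTransform μ).aemeasurable (measurable_pairCopula i j).aestronglyMeasurable]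
  simp_rw [integral_kendallKernel_fst, integral_const_mul, pairCopula_marginalCDF hcont]

theorem empiricalKendallMatrix_apply (n : ℕ) (x : ℕ → Fin d → ℝ) (i j : Fin d) :
    empiricalKendallMatrix n x i j = -1 + uStatistic (kendallKernel i j) n x := by
  simp only [empiricalKendallMatrix, Matrix.of_apply, uStatistic, kendallKernel]
  rw [← Finset.mul_sum, ← mul_assoc, one_div_mul_eq_div]

/-- Asymptotic normality of the empirical Kendall vector. -/
theorem tendstoInDistribution_empiricalKendallVec (hcont : ∀ j, Continuous (marginalCDF μ j))
    {Ω : Type*} [MeasurableSpace Ω] {P : Measure Ω} [IsProbabilityMeasure P]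
    {X : ℕ → Ω → Fin d → ℝ} (hlaw : ∀ m, HasLaw (X m) μ P) (hindep : iIndepFun X P) :
    TendstoInDistribution
      (fun (n : ℕ) ω => √(n : ℝ) • (empiricalKendallVec n (fun m => X m ω) - kendallVec μ))
      atTop id (fun _ => P) (multivariateGaussian 0 (asymptoticCov μ)) := by
  have h := tendstoInDistribution_uStatistic (ι := UpperPair d) hlaw hindep
    (fun r => measurable_kendallKernel r.1.1 r.1.2) (fun r => abs_kendallKernel_le r.1.1 r.1.2)
  rw [covMatrix_kendallKernel hcont] at h
  convert h using 3 with n ω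
  ext r
  simp only [PiLp.smul_apply, PiLp.sub_apply, empiricalKendallVec, kendallVec, upperVec,
    smul_eq_mul]
  rw [empiricalKendallMatrix_apply, kendallMatrix_eq_integral_kendallKernel hcont,
    add_sub_add_left_eq_sub]

theorem asymptoticCov_posSemidef (hcont : ∀ j, Continuous (marginalCDF μ j)) :
    (asymptoticCov μ).PosSemidef := by
  rw [← covMatrix_kendallKernel hcont]
  exact covMatrix_posSemidef fun r => memLp_hajekProjection
    (measurable_kendallKernel r.1.1 r.1.2) (abs_kendallKernel_le r.1.1 r.1.2)

end Kendall

/-! ### Linear images of Gaussian limits -/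

section LinearImage

variable {ι : Type*} [Fintype ι] [DecidableEq ι]

omit [DecidableEq ι] in
theorem continuous_toLp_mulVec (A : Matrix ι ι ℝ) :
    Continuous fun x : EuclideanSpace ℝ ι => WithLp.toLp 2 (A *ᵥ WithLp.ofLp x) :=
  (PiLp.continuous_toLp 2 _).comp
    (continuous_const.matrix_mulVec (PiLp.continuous_ofLp 2 _))

theorem multivariateGaussian_map_mulVec {S : Matrix ι ι ℝ} (hS : S.PosSemidef)
    (A : Matrix ι ι ℝ) :
    (multivariateGaussian 0 S).map (fun x => WithLp.toLp 2 (A *ᵥ WithLp.ofLp x))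
      = multivariateGaussian 0 (A * S * Aᵀ) := by
  have hAS : (A * S * Aᵀ).PosSemidef := by
    simpa [Matrix.conjTranspose_eq_transpose_of_trivial] using hS.mul_mul_conjTranspose_same A
  have hL := continuous_toLp_mulVec A
  have : IsProbabilityMeasure ((multivariateGaussian 0 S).map
      fun x : EuclideanSpace ℝ ι => WithLp.toLp 2 (A *ᵥ WithLp.ofLp x)) :=
    Measure.isProbabilityMeasure_map hL.measurable.aemeasurable
  refine Measure.ext_of_charFun (E := EuclideanSpace ℝ ι) ?_
  ext t
  have hinner : ∀ x : EuclideanSpace ℝ ι,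
      inner ℝ (WithLp.toLp 2 (A *ᵥ WithLp.ofLp x) : EuclideanSpace ℝ ι) t
        = inner ℝ x (WithLp.toLp 2 (Aᵀ *ᵥ WithLp.ofLp t)) := fun x => by
    simp only [EuclideanSpace.inner_eq_star_dotProduct, star_trivial]
    rw [Matrix.dotProduct_mulVec, Matrix.mulVec_transpose]
  rw [charFun_apply, integral_map hL.measurable.aemeasurable (by fun_prop)]
  simp_rw [hinner]
  rw [← charFun_apply, charFun_multivariateGaussian hS, charFun_multivariateGaussian hAS]
  have hquad : (Aᵀ *ᵥ WithLp.ofLp t) ⬝ᵥ S *ᵥ (Aᵀ *ᵥ WithLp.ofLp t)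
      = WithLp.ofLp t ⬝ᵥ (A * S * Aᵀ) *ᵥ WithLp.ofLp t := by
    rw [← Matrix.mulVec_mulVec, ← Matrix.mulVec_mulVec, Matrix.dotProduct_mulVec _ A,
      Matrix.mulVec_transpose]
  simp only [hquad, inner_zero_right]

/-- Convergence in distribution to a centred Gaussian vector is preserved by a linear map `A`, the
limit covariance `S` becoming `A S Aᵀ`. -/
theorem tendstoInDistribution_mulVec_multivariateGaussian {Ω : Type*} [MeasurableSpace Ω]
    {P : Measure Ω} [IsProbabilityMeasure P] {Z : ℕ → Ω → EuclideanSpace ℝ ι}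
    {S : Matrix ι ι ℝ} (hS : S.PosSemidef) (A : Matrix ι ι ℝ)
    (h : TendstoInDistribution Z atTop id (fun _ => P) (multivariateGaussian 0 S)) :
    TendstoInDistribution (fun n ω => WithLp.toLp 2 (A *ᵥ WithLp.ofLp (Z n ω))) atTop id
      (fun _ => P) (multivariateGaussian 0 (A * S * Aᵀ)) := by
  have h' := h.continuous_comp (continuous_toLp_mulVec A)
  have heq : (⟨(multivariateGaussian 0 (A * S * Aᵀ)).map id,
        Measure.isProbabilityMeasure_map aemeasurable_id⟩ :
          ProbabilityMeasure (EuclideanSpace ℝ ι))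
      = ⟨_, Measure.isProbabilityMeasure_map h'.aemeasurable_limit⟩ := by
    refine Subtype.ext ?_
    simp only [Function.comp_id, Measure.map_id]
    exact (multivariateGaussian_map_mulVec hS A).symm
  refine ⟨h'.forall_aemeasurable, aemeasurable_id, ?_⟩
  rw [heq]
  exact h'.tendsto

end LinearImage

/-! ### Invariance of the copula law -/

section CopulaLaw

variable {d : ℕ} {μ : Measure (Fin d → ℝ)} [IsProbabilityMeasure μ]

/-- A law on `ℝᵈ` is determined by its joint distribution function. -/
theorem ext_of_forall_le {ν ρ : Measure (Fin d → ℝ)} [IsProbabilityMeasure ν]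
    [IsProbabilityMeasure ρ]
    (h : ∀ u : Fin d → ℝ, ν.real {v | ∀ j, v j ≤ u j} = ρ.real {v | ∀ j, v j ≤ u j}) : ν = ρ := by
  have hspan : IsCountablySpanning (Set.range (Set.Iic : ℝ → Set ℝ)) := by
    refine ⟨fun n : ℕ => Set.Iic (n : ℝ), fun n => ⟨n, rfl⟩, ?_⟩
    exact Set.iUnion_eq_univ_iff.2 fun x => exists_nat_ge x
  have hgen : (MeasurableSpace.pi : MeasurableSpace (Fin d → ℝ)) = MeasurableSpace.generateFrom
      (Set.pi Set.univ '' Set.pi Set.univ fun _ : Fin d => Set.range (Set.Iic : ℝ → Set ℝ)) :=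
    (generateFrom_eq_pi (fun _ => by
      rw [← borel_eq_generateFrom_Iic]; exact (BorelSpace.measurable_eq (α := ℝ)).symm)
      fun _ => hspan).symm
  refine ext_of_generate_finite _ hgen (IsPiSystem.pi fun _ => isPiSystem_Iic) ?_ (by simp)
  rintro _ ⟨s, hs, rfl⟩
  choose u hu using fun j => hs j (Set.mem_univ j)
  have hset : Set.pi Set.univ s = {v | ∀ j, v j ≤ u j} := by
    ext v
    simp [← hu]
  rw [hset]
  exact (measureReal_eq_measureReal_iff).1 (h u)

omit [IsProbabilityMeasure μ] in
theorem probTransform_nonneg (x : Fin d → ℝ) (j : Fin d) : 0 ≤ probTransform μ x j :=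
  cdf_nonneg _ _

omit [IsProbabilityMeasure μ] in
theorem probTransform_le_one (x : Fin d → ℝ) (j : Fin d) : probTransform μ x j ≤ 1 :=
  cdf_le_one _ _

theorem measurableSet_forall_le (u : Fin d → ℝ) :
    MeasurableSet {v : Fin d → ℝ | ∀ j, v j ≤ u j} := by
  rw [Set.ofPred_forall]
  exact MeasurableSet.iInter fun j => measurableSet_le (measurable_pi_apply j) measurable_const

omit [IsProbabilityMeasure μ] in
theorem copula_eq_real (u : Fin d → ℝ) :
    copula μ u = μ.real {x | ∀ j, probTransform μ x j ≤ u j} := by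
  rw [copula, copulaLaw, map_measureReal_apply (measurable_probTransform μ)
    (measurableSet_forall_le u)]
  rfl

omit [IsProbabilityMeasure μ] in
theorem copula_min_one (u : Fin d → ℝ) : copula μ (fun j => min (u j) 1) = copula μ u := by
  simp_rw [copula_eq_real, le_min_iff, probTransform_le_one, and_true]

omit [IsProbabilityMeasure μ] in
theorem copula_of_neg {u : Fin d → ℝ} {j : Fin d} (hj : u j < 0) : copula μ u = 0 := by
  have h : {x | ∀ j, probTransform μ x j ≤ u j} = ∅ :=
    Set.eq_empty_of_forall_notMem fun x hx => (hx j).not_gt (hj.trans_le (probTransform_nonneg x j))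
  rw [copula_eq_real, h, measureReal_empty]

/-- The permutation `π` maps each cluster of `G` to itself. -/
def PreservesParts (G : Finpartition (Finset.univ : Finset (Fin d))) (π : Equiv.Perm (Fin d)) :
    Prop :=
  ∀ j, ∀ A ∈ G.parts, j ∈ A ↔ π j ∈ A

theorem PreservesParts.inv {G : Finpartition (Finset.univ : Finset (Fin d))}
    {π : Equiv.Perm (Fin d)} (hπ : PreservesParts G π) : PreservesParts G π⁻¹ := fun j A hA => by
  rw [hπ (π⁻¹ j) A hA, Equiv.Perm.coe_inv, Equiv.apply_symm_apply]

omit [IsProbabilityMeasure μ] in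
/-- Partial exchangeability, assumed on the unit cube only, extends to all arguments. -/
theorem PartiallyExchangeable.copula_comp
    {G : Finpartition (Finset.univ : Finset (Fin d))} (hG : PartiallyExchangeable μ G)
    {π : Equiv.Perm (Fin d)} (hπ : PreservesParts G π) (u : Fin d → ℝ) :
    copula μ (fun j => u (π j)) = copula μ u := by
  by_cases h : ∃ j, u j < 0
  · obtain ⟨j, hj⟩ := h
    rw [copula_of_neg hj, copula_of_neg (j := π⁻¹ j) (by simpa using hj)]
  · push Not at h
    rw [← copula_min_one u, ← copula_min_one fun j => u (π j)]
    exact (hG (fun j => min (u j) 1) (fun j => ⟨le_min (h j) zero_le_one, min_le_right _ _⟩)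
      π hπ).symm

theorem measurable_comp_perm (π : Equiv.Perm (Fin d)) :
    Measurable fun (v : Fin d → ℝ) j => v (π j) :=
  measurable_pi_lambda _ fun j => measurable_pi_apply (π j)

theorem PartiallyExchangeable.copulaLaw_map
    {G : Finpartition (Finset.univ : Finset (Fin d))} (hG : PartiallyExchangeable μ G)
    {π : Equiv.Perm (Fin d)} (hπ : PreservesParts G π) :
    (copulaLaw μ).map (fun v j => v (π j)) = copulaLaw μ := by
  have : IsProbabilityMeasure ((copulaLaw μ).map fun v j => v (π j)) :=
    Measure.isProbabilityMeasure_map (measurable_comp_perm π).aemeasurable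
  refine ext_of_forall_le fun u => ?_
  rw [map_measureReal_apply (measurable_comp_perm π) (measurableSet_forall_le u)]
  have hset : (fun (v : Fin d → ℝ) j => v (π j)) ⁻¹' {v | ∀ j, v j ≤ u j}
      = {v | ∀ j, v j ≤ u (π⁻¹ j)} := by
    ext v
    exact ⟨fun h j => by simpa using h (π⁻¹ j), fun h j => by simpa using h (π j)⟩
  rw [hset]
  exact hG.copula_comp hπ.inv u

/-- The score `C_{ij}(v_i, v_j) + C̄_{ij}(v_i, v_j)` of the pair `(i, j)`. -/
noncomputable def kendallScore (μ : Measure (Fin d → ℝ)) (i j : Fin d) (v : Fin d → ℝ) : ℝ :=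
  pairCopula μ i j (v i) (v j) + pairSurvival μ i j (v i) (v j)

theorem measurable_kendallScore (i j : Fin d) : Measurable (kendallScore μ i j) :=
  (measurable_pairCopula i j).add (measurable_pairSurvival i j)

omit [IsProbabilityMeasure μ] in
theorem pairCopula_swap (i j : Fin d) (a b : ℝ) : pairCopula μ j i b a = pairCopula μ i j a b := by
  simp only [pairCopula, and_comm]

omit [IsProbabilityMeasure μ] in
theorem kendallScore_swap (i j : Fin d) : kendallScore μ j i = kendallScore μ i j := by
  ext v
  simp only [kendallScore, pairCopula_swap i j, pairSurvival, and_comm]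

section Perm

variable {G : Finpartition (Finset.univ : Finset (Fin d))} (hG : PartiallyExchangeable μ G)
  {π : Equiv.Perm (Fin d)} (hπ : PreservesParts G π)

include hG hπ

theorem PartiallyExchangeable.pairCopula_perm (i j : Fin d) (a b : ℝ) :
    pairCopula μ (π i) (π j) a b = pairCopula μ i j a b := by
  have hm : MeasurableSet {v : Fin d → ℝ | v i ≤ a ∧ v j ≤ b} :=
    (measurableSet_le (measurable_pi_apply i) measurable_const).inter
      (measurableSet_le (measurable_pi_apply j) measurable_const)
  rw [pairCopula, pairCopula, ← hG.copulaLaw_map hπ,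
    map_measureReal_apply (measurable_comp_perm π) hm, hG.copulaLaw_map hπ]
  rfl

theorem PartiallyExchangeable.pairSurvival_perm (i j : Fin d) (a b : ℝ) :
    pairSurvival μ (π i) (π j) a b = pairSurvival μ i j a b := by
  have hm : MeasurableSet {v : Fin d → ℝ | a < v i ∧ b < v j} :=
    (measurableSet_lt measurable_const (measurable_pi_apply i)).inter
      (measurableSet_lt measurable_const (measurable_pi_apply j))
  rw [pairSurvival, pairSurvival, ← hG.copulaLaw_map hπ,
    map_measureReal_apply (measurable_comp_perm π) hm, hG.copulaLaw_map hπ]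
  rfl

theorem PartiallyExchangeable.covariance_kendallScore_perm (i j k l : Fin d) :
    cov[kendallScore μ (π i) (π j), kendallScore μ (π k) (π l); copulaLaw μ]
      = cov[kendallScore μ i j, kendallScore μ k l; copulaLaw μ] := by
  have hscore : ∀ i j, kendallScore μ (π i) (π j)
      = kendallScore μ i j ∘ fun (v : Fin d → ℝ) j => v (π j) := fun i j => by
    ext v
    simp only [kendallScore, Function.comp_apply, hG.pairCopula_perm hπ, hG.pairSurvival_perm hπ]
  rw [hscore, hscore, ← covariance_map (measurable_kendallScore i j).aestronglyMeasurable
    (measurable_kendallScore k l).aestronglyMeasurable (measurable_comp_perm π).aemeasurable,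
    hG.copulaLaw_map hπ]

theorem PartiallyExchangeable.integral_pairCopula_perm (i j : Fin d) :
    ∫ v, pairCopula μ (π i) (π j) (v (π i)) (v (π j)) ∂copulaLaw μ
      = ∫ v, pairCopula μ i j (v i) (v j) ∂copulaLaw μ := by
  simp_rw [hG.pairCopula_perm hπ]
  conv_rhs => rw [← hG.copulaLaw_map hπ]
  rw [integral_map (measurable_comp_perm π).aemeasurable
    (by rw [hG.copulaLaw_map hπ]; exact (measurable_pairCopula i j).aestronglyMeasurable)]

end Perm

end CopulaLaw

/-! ### Blocks and the projection `Γ` -/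

section Blocks

variable {d : ℕ} {G : Finpartition (Finset.univ : Finset (Fin d))}

/-- The action of a permutation of the coordinates on the positions above the diagonal, a position
being regarded as an unordered pair. -/
def permUpperPair (π : Equiv.Perm (Fin d)) (r : UpperPair d) : UpperPair d :=
  if h : π r.1.1 < π r.1.2 then ⟨(π r.1.1, π r.1.2), h⟩
  else ⟨(π r.1.2, π r.1.1), lt_of_le_of_ne (not_lt.1 h) fun e => r.2.ne' (π.injective e)⟩

theorem apply_permUpperPair {γ : Sort*} (π : Equiv.Perm (Fin d)) (r : UpperPair d)
    {f : Fin d → Fin d → γ} (hf : ∀ i j, f i j = f j i) :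
    f (permUpperPair π r).1.1 (permUpperPair π r).1.2 = f (π r.1.1) (π r.1.2) := by
  unfold permUpperPair
  split_ifs with h
  · rfl
  · exact hf _ _

theorem upperPair_ext {r s : UpperPair d} (h : s(r.1.1, r.1.2) = s(s.1.1, s.1.2)) : r = s := by
  obtain ⟨⟨i, j⟩, hij⟩ := r
  obtain ⟨⟨k, l⟩, hkl⟩ := s
  simp only [Sym2.eq_iff] at h hij hkl
  rcases h with ⟨rfl, rfl⟩ | ⟨rfl, rfl⟩
  · rfl
  · exact absurd hij hkl.not_gt

theorem permUpperPair_eq_iff {π : Equiv.Perm (Fin d)} {r s : UpperPair d} :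
    permUpperPair π r = s ↔ s(π r.1.1, π r.1.2) = s(s.1.1, s.1.2) := by
  have h := apply_permUpperPair π r (f := fun i j => s(i, j)) fun _ _ => Sym2.eq_swap
  rw [← h]
  exact ⟨fun e => by rw [e], upperPair_ext⟩

theorem permUpperPair_inv_permUpperPair (π : Equiv.Perm (Fin d)) (r : UpperPair d) :
    permUpperPair π⁻¹ (permUpperPair π r) = r := by
  rw [permUpperPair_eq_iff, apply_permUpperPair π r (f := fun i j => s(π⁻¹ i, π⁻¹ j))
    fun _ _ => Sym2.eq_swap]
  simp

theorem mem_pairBlock {A A' : Finset (Fin d)} {r : UpperPair d} :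
    r ∈ pairBlock A A' ↔ (r.1.1 ∈ A ∧ r.1.2 ∈ A') ∨ (r.1.1 ∈ A' ∧ r.1.2 ∈ A) := by
  simp [pairBlock]

theorem mem_blockPartition {b : Finset (UpperPair d)} :
    b ∈ blockPartition G ↔
      (∃ A ∈ G.parts, ∃ A' ∈ G.parts, pairBlock A A' = b) ∧ b.Nonempty := by
  simp only [blockPartition, Finset.mem_filter, Finset.mem_image, Finset.mem_product,
    Prod.exists]
  refine and_congr_left fun _ => ⟨?_, ?_⟩
  · rintro ⟨A, A', ⟨hA, hA'⟩, h⟩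
    exact ⟨A, hA, A', hA', h⟩
  · rintro ⟨A, hA, A', hA', h⟩
    exact ⟨A, A', ⟨hA, hA'⟩, h⟩

theorem mem_of_mem_permUpperPair {π : Equiv.Perm (Fin d)} (hπ : PreservesParts G π)
    {b : Finset (UpperPair d)} (hb : b ∈ blockPartition G) (r : UpperPair d) :
    permUpperPair π r ∈ b ↔ r ∈ b := by
  obtain ⟨⟨A, hA, A', hA', rfl⟩, -⟩ := mem_blockPartition.1 hb
  rw [mem_pairBlock, mem_pairBlock, apply_permUpperPair π r
    (f := fun i j => (i ∈ A ∧ j ∈ A') ∨ (i ∈ A' ∧ j ∈ A)) fun i j => by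
      rw [or_comm, and_comm, and_comm (a := i ∈ A)], ← hπ _ A hA, ← hπ _ A hA, ← hπ _ A' hA',
    ← hπ _ A' hA']

theorem pairBlock_comm (A A' : Finset (Fin d)) : pairBlock A A' = pairBlock A' A := by
  ext r
  rw [mem_pairBlock, mem_pairBlock, or_comm]

/-- The blocks are pairwise disjoint. -/
theorem eq_of_mem_blockPartition {b c : Finset (UpperPair d)} (hb : b ∈ blockPartition G)
    (hc : c ∈ blockPartition G) {r : UpperPair d} (hrb : r ∈ b) (hrc : r ∈ c) : b = c := by
  obtain ⟨⟨A, hA, A', hA', rfl⟩, -⟩ := mem_blockPartition.1 hb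
  obtain ⟨⟨C, hC, C', hC', rfl⟩, -⟩ := mem_blockPartition.1 hc
  have key : ∀ {D E : Finset (Fin d)}, D ∈ G.parts → E ∈ G.parts → ∀ {i}, i ∈ D → i ∈ E → D = E :=
    fun hD hE _ h1 h2 => G.eq_of_mem_parts hD hE h1 h2
  rw [mem_pairBlock] at hrb hrc
  rcases hrb with ⟨h1, h2⟩ | ⟨h1, h2⟩ <;> rcases hrc with ⟨h3, h4⟩ | ⟨h3, h4⟩
  · rw [key hA hC h1 h3, key hA' hC' h2 h4]
  · rw [key hA hC' h1 h3, key hA' hC h2 h4, pairBlock_comm]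
  · rw [key hA' hC h1 h3, key hA hC' h2 h4, pairBlock_comm]
  · rw [key hA' hC' h1 h3, key hA hC h2 h4]

theorem exists_mem_blockPartition (G : Finpartition (Finset.univ : Finset (Fin d)))
    (r : UpperPair d) : ∃ b ∈ blockPartition G, r ∈ b := by
  have h1 := G.part_mem.2 (Finset.mem_univ r.1.1)
  have h2 := G.part_mem.2 (Finset.mem_univ r.1.2)
  have hr : r ∈ pairBlock (G.part r.1.1) (G.part r.1.2) :=
    mem_pairBlock.2 (.inl ⟨G.mem_part (Finset.mem_univ _), G.mem_part (Finset.mem_univ _)⟩)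
  exact ⟨_, mem_blockPartition.2 ⟨⟨_, h1, _, h2, rfl⟩, r, hr⟩, hr⟩

theorem preservesParts_swap {A : Finset (Fin d)} (hA : A ∈ G.parts) {i k : Fin d} (hi : i ∈ A)
    (hk : k ∈ A) : PreservesParts G (Equiv.swap i k) := by
  intro j C hC
  have hik : i ∈ C ↔ k ∈ C :=
    ⟨fun h => G.eq_of_mem_parts hA hC hi h ▸ hk, fun h => G.eq_of_mem_parts hA hC hk h ▸ hi⟩
  rcases eq_or_ne j i with rfl | h1
  · rw [Equiv.swap_apply_left, hik]
  rcases eq_or_ne j k with rfl | h2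
  · rw [Equiv.swap_apply_right, hik]
  rw [Equiv.swap_apply_of_ne_of_ne h1 h2]

theorem PreservesParts.mul {π σ : Equiv.Perm (Fin d)} (hπ : PreservesParts G π)
    (hσ : PreservesParts G σ) : PreservesParts G (π * σ) := fun j A hA =>
  (hσ j A hA).trans (hπ (σ j) A hA)

theorem exists_preservesParts_apply_eq {A A' : Finset (Fin d)} (hA : A ∈ G.parts)
    (hA' : A' ∈ G.parts) {i j k l : Fin d} (hi : i ∈ A) (hk : k ∈ A) (hj : j ∈ A') (hl : l ∈ A')
    (hij : i ≠ j) (hkl : k ≠ l) : ∃ π, PreservesParts G π ∧ π i = k ∧ π j = l := by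
  have h1 := preservesParts_swap hA hi hk
  refine ⟨Equiv.swap (Equiv.swap i k j) l * Equiv.swap i k,
    (preservesParts_swap hA' ((h1 j A' hA').1 hj) hl).mul h1, ?_, ?_⟩
  · have hne : k ≠ Equiv.swap i k j := fun e => hij ((Equiv.swap i k).injective (by simpa using e))
    rw [Equiv.Perm.mul_apply, Equiv.swap_apply_left, Equiv.swap_apply_of_ne_of_ne hne hkl]
  · rw [Equiv.Perm.mul_apply, Equiv.swap_apply_left]

/-- The cluster-preserving permutations act transitively on each block. -/
theorem exists_permUpperPair_eq {b : Finset (UpperPair d)} (hb : b ∈ blockPartition G)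
    {r s : UpperPair d} (hr : r ∈ b) (hs : s ∈ b) :
    ∃ π, PreservesParts G π ∧ permUpperPair π r = s := by
  obtain ⟨⟨A, hA, A', hA', rfl⟩, -⟩ := mem_blockPartition.1 hb
  rw [mem_pairBlock] at hr hs
  simp only [permUpperPair_eq_iff, Sym2.eq_iff]
  have hr' := r.2.ne
  have hs' := s.2.ne
  rcases hr with ⟨h1, h2⟩ | ⟨h1, h2⟩ <;> rcases hs with ⟨h3, h4⟩ | ⟨h3, h4⟩
  · obtain ⟨π, hπ, e⟩ := exists_preservesParts_apply_eq hA hA' h1 h3 h2 h4 hr' hs'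
    exact ⟨π, hπ, .inl e⟩
  · obtain ⟨π, hπ, e⟩ := exists_preservesParts_apply_eq hA hA' h1 h4 h2 h3 hr' hs'.symm
    exact ⟨π, hπ, .inr e⟩
  · obtain ⟨π, hπ, e⟩ := exists_preservesParts_apply_eq hA' hA h1 h4 h2 h3 hr' hs'.symm
    exact ⟨π, hπ, .inr e⟩
  · obtain ⟨π, hπ, e⟩ := exists_preservesParts_apply_eq hA' hA h1 h3 h2 h4 hr' hs'
    exact ⟨π, hπ, .inl e⟩

theorem blockProjection_mul_blockMembership (G : Finpartition (Finset.univ : Finset (Fin d))) :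
    blockProjection G * blockMembership G = blockMembership G :=
  (moorePenroseInverse_spec _).mul_mul_self

theorem blockProjection_transpose (G : Finpartition (Finset.univ : Finset (Fin d))) :
    (blockProjection G)ᵀ = blockProjection G :=
  (moorePenroseInverse_spec _).symm_left

theorem blockProjection_mul_self (G : Finpartition (Finset.univ : Finset (Fin d))) :
    blockProjection G * blockProjection G = blockProjection G := by
  nth_rw 2 [blockProjection]
  rw [← Matrix.mul_assoc, blockProjection_mul_blockMembership]
  rfl

/-- A vector that is constant on the blocks lies in the column space of `B`, so `Γ` fixes it. -/
theorem blockProjection_mulVec_of_invariant {v : UpperPair d → ℝ}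
    (hv : ∀ π, PreservesParts G π → ∀ r, v (permUpperPair π r) = v r) :
    blockProjection G *ᵥ v = v := by
  have hrange : v = blockMembership G *ᵥ fun b => v (mem_blockPartition.1 b.2).2.choose := by
    ext r
    obtain ⟨b, hb, hrb⟩ := exists_mem_blockPartition G r
    simp only [Matrix.mulVec, dotProduct, blockMembership, Matrix.of_apply, ite_mul, one_mul,
      zero_mul]
    rw [Finset.sum_eq_single ⟨b, hb⟩ (fun c _ hc => if_neg fun hrc =>
      hc (Subtype.ext (eq_of_mem_blockPartition c.2 hb hrc hrb))) (by simp), if_pos hrb]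
    obtain ⟨π, hπ, e⟩ := exists_permUpperPair_eq hb (mem_blockPartition.1 hb).2.choose_spec hrb
    rw [← e, hv π hπ]
  rw [hrange, Matrix.mulVec_mulVec, blockProjection_mul_blockMembership]

/-- If `S` is symmetric and invariant under the cluster-preserving permutations, then `S` maps the
column space of `B` to itself. As `Γ` is the orthogonal projection onto that space, the two
commute. -/
theorem blockProjection_mul_comm {S : Matrix (UpperPair d) (UpperPair d) ℝ} (hS : Sᵀ = S)
    (hinv : ∀ π, PreservesParts G π → ∀ r s, S (permUpperPair π r) (permUpperPair π s) = S r s) :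
    blockProjection G * S = S * blockProjection G := by
  have hcol : blockProjection G * (S * blockMembership G) = S * blockMembership G := by
    ext r b
    refine congrFun (blockProjection_mulVec_of_invariant (G := G)
      (v := fun r => (S * blockMembership G) r b) fun π hπ r => ?_) r
    simp only [Matrix.mul_apply, blockMembership, Matrix.of_apply]
    have hperm : Function.Bijective (permUpperPair π) := Function.bijective_iff_has_inverse.2
      ⟨permUpperPair π⁻¹, permUpperPair_inv_permUpperPair π, fun s => by
        simpa using permUpperPair_inv_permUpperPair π⁻¹ s⟩
    refine (Fintype.sum_bijective _ hperm _ _ fun s => ?_).symm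
    rw [hinv π hπ]
    simp only [mem_of_mem_permUpperPair hπ b.2]
  have h1 : blockProjection G * (S * blockProjection G) = S * blockProjection G := by
    conv_lhs => enter [2, 2]; rw [blockProjection]
    rw [← Matrix.mul_assoc S, ← Matrix.mul_assoc, hcol, Matrix.mul_assoc]
    rfl
  have h2 := congrArg Matrix.transpose h1
  simp only [Matrix.transpose_mul, hS, blockProjection_transpose] at h2
  rw [← h2, Matrix.mul_assoc, h1]

end Blocks

/-! ### Asymptotic efficiency of block averaging -/

section Exchangeable

variable {d : ℕ} {μ : Measure (Fin d → ℝ)} [IsProbabilityMeasure μ]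
  {G : Finpartition (Finset.univ : Finset (Fin d))}

theorem PartiallyExchangeable.asymptoticCov_perm (hG : PartiallyExchangeable μ G)
    {π : Equiv.Perm (Fin d)} (hπ : PreservesParts G π) (r s : UpperPair d) :
    asymptoticCov μ (permUpperPair π r) (permUpperPair π s) = asymptoticCov μ r s := by
  change 16 * cov[kendallScore μ _ _, kendallScore μ _ _; copulaLaw μ]
    = 16 * cov[kendallScore μ r.1.1 r.1.2, kendallScore μ s.1.1 s.1.2; copulaLaw μ]
  rw [apply_permUpperPair π r (f := kendallScore μ) fun i j => kendallScore_swap j i,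
    apply_permUpperPair π s (f := kendallScore μ) fun i j => kendallScore_swap j i,
    hG.covariance_kendallScore_perm hπ]

theorem PartiallyExchangeable.kendallMatrix_perm (hG : PartiallyExchangeable μ G)
    (hcont : ∀ j, Continuous (marginalCDF μ j)) {π : Equiv.Perm (Fin d)}
    (hπ : PreservesParts G π) (r : UpperPair d) :
    upperVec (kendallMatrix μ) (permUpperPair π r) = upperVec (kendallMatrix μ) r := by
  have hsymm : ∀ i j, kendallMatrix μ i j = kendallMatrix μ j i := fun i j => by
    simp only [kendallMatrix, Matrix.of_apply, mul_comm]
  simp only [upperVec]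
  rw [apply_permUpperPair π r (f := kendallMatrix μ) hsymm,
    kendallMatrix_eq_integral_pairCopula hcont, kendallMatrix_eq_integral_pairCopula hcont,
    hG.integral_pairCopula_perm hπ]

end Exchangeable

theorem theorem2 {d : ℕ} (μ : Measure (Fin d → ℝ)) [IsProbabilityMeasure μ]
    (hcont : ∀ j, Continuous (marginalCDF μ j))
    (G : Finpartition (Finset.univ : Finset (Fin d)))
    (hG : PartiallyExchangeable μ G)
    {Ω : Type*} [MeasurableSpace Ω] (P : Measure Ω) [IsProbabilityMeasure P]
    (X : ℕ → Ω → Fin d → ℝ) (hlaw : ∀ m, HasLaw (X m) μ P) (hindep : iIndepFun X P) :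
    TendstoInDistribution
        (fun (n : ℕ) ω => √(n : ℝ) • (empiricalKendallVec n (fun m => X m ω) - kendallVec μ))
        atTop id (fun _ => P) (multivariateGaussian 0 (asymptoticCov μ)) ∧
      (blockProjection G * asymptoticCov μ).PosSemidef ∧
      TendstoInDistribution
        (fun (n : ℕ) ω =>
          √(n : ℝ) • (blockAveragedKendallVec G n (fun m => X m ω) - kendallVec μ))
        atTop id (fun _ => P)
        (multivariateGaussian 0 (blockProjection G * asymptoticCov μ)) ∧
      (asymptoticCov μ - blockProjection G * asymptoticCov μ).PosSemidef := by
  have hS := asymptoticCov_posSemidef hcont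
  have hclt := tendstoInDistribution_empiricalKendallVec hcont hlaw hindep
  have hSt : (asymptoticCov μ)ᵀ = asymptoticCov μ := by
    simpa [Matrix.conjTranspose_eq_transpose_of_trivial] using hS.isHermitian.eq
  have hcomm : blockProjection G * asymptoticCov μ = asymptoticCov μ * blockProjection G :=
    blockProjection_mul_comm hSt fun π hπ => hG.asymptoticCov_perm hπ
  -- `Γ` is an orthogonal projection commuting with `Σ_∞`, so `Γ Σ_∞ = Γ Σ_∞ Γᵀ`, and likewise for
  -- the complementary projection `1 - Γ`.
  have hsandwich : blockProjection G * asymptoticCov μ * (blockProjection G)ᵀ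
      = blockProjection G * asymptoticCov μ := by
    rw [blockProjection_transpose, Matrix.mul_assoc, ← hcomm, ← Matrix.mul_assoc,
      blockProjection_mul_self]
  have hsandwich' : (1 - blockProjection G) * asymptoticCov μ * (1 - blockProjection G)ᵀ
      = asymptoticCov μ - blockProjection G * asymptoticCov μ := by
    rw [Matrix.transpose_sub, Matrix.transpose_one, Matrix.mul_sub, Matrix.mul_one, Matrix.sub_mul,
      Matrix.one_mul, Matrix.sub_mul, hsandwich, blockProjection_transpose, ← hcomm, sub_self,
      sub_zero]
  refine ⟨hclt, ?_, ?_, ?_⟩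
  · rw [← hsandwich]
    simpa only [Matrix.conjTranspose_eq_transpose_of_trivial] using
      hS.mul_mul_conjTranspose_same (blockProjection G)
  · have h := tendstoInDistribution_mulVec_multivariateGaussian hS (blockProjection G) hclt
    rw [hsandwich] at h
    convert h using 3 with n ω
    have hτ : blockProjection G *ᵥ upperVec (kendallMatrix μ) = upperVec (kendallMatrix μ) :=
      blockProjection_mulVec_of_invariant fun π hπ r => hG.kendallMatrix_perm hcont hπ r
    simp only [blockAveragedKendallVec, kendallVec, empiricalKendallVec, WithLp.ofLp_smul,
      WithLp.ofLp_sub, Matrix.mulVec_smul, Matrix.mulVec_sub, hτ, WithLp.toLp_smul,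
      WithLp.toLp_sub]
  · rw [← hsandwich']
    simpa only [Matrix.conjTranspose_eq_transpose_of_trivial] using
      hS.mul_mul_conjTranspose_same (1 - blockProjection G)
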